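/- Spaces, products and function spaces are taken in the category of compactly generated spaces. For a space $Y$ with base point $*$, let $\Omega Y$ be the space of loops at $*$, let $LY$ be the free loop space, and let $i_Y\colon \Omega Y\to LY$ and $s_Y\colon Y\to LY$ be the inclusion and the constant-loop section. An H-space is a based space with a multiplication for which the base point is a two-sided unit up to based homotopy. If $Y$ is an H-space then $LY$ is an H-space under pointwise multiplication, and multiplying $i_Y$ and $s_Y$ gives $\theta_Y\colon \Omega Y\times Y\to LY$, $\theta_Y(\gamma,y)(t)=\gamma(t)\,y$. Let $B$ and $C$ be H-spaces which have the homotopy type of CW complexes and have non-degenerate base points. Suppose that $C$ is homotopy-associative and that the monoid $\pi_0(C)$ is a group (for example, that $C$ is path connected). Let $w\colon B\to C$ be any based map (not necessarily an H-map). A deviation of $Lw$ is a based map $D\colon LB\wedge LB\to LC$ such that the maps $(x,y)\mapsto D(x\wedge y)\cdot Lw(xy)$ and $(x,y)\mapsto Lw(x)\cdot Lw(y)$ from $LB\times LB$ to $LC$ are based homotopic. **Theorem.** A deviation $D$ of $Lw$ exists. For every deviation $D$, the composite $$\Omega B\wedge B\xrightarrow{\,i_B\wedge s_B\,}LB\wedge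 LB\xrightarrow{\;D\;}LC$$ lifts, up to based homotopy, through $i_C$ to a based map $\delta\colon\Omega B\wedge B\to\Omega C$. For every such $D$ and every such lift $\delta$, let $\mathfrak D\colon\Omega B\wedge B\to\Omega C$ be the inverse of $\delta$, that is, $\delta$ followed by loop reversal. Then the composite $$\Omega B\times B\xrightarrow{\;\theta_B\;}LB\xrightarrow{\;Lw\;}LC$$ is based homotopic to the composite $$\Omega B\times B\xrightarrow{(\mathbf s,\,1)}(\Omega B\wedge B)\times(\Omega B\times B)\xrightarrow{\mathfrak D\times\Omega w\times w}\Omega C\times\Omega C\times C\xrightarrow{\mu\times 1}\Omega C\times C\xrightarrow{\;\theta_C\;}LC,$$ where $\mathbf s\colon\Omega B\times B\to\Omega B\wedge B$ is the quotient map and $\mu$ is concatenation of loops. -/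

import Mathlib

open Topology unitInterval

universe u

namespace ConvenientHSpaces

/-! ### The convenient category of compactly generated spaces

Products and function spaces carry the compactly generated topology attached to the usual product
topology and to the usual compact-open topology. -/

/-- The compact Hausdorff spaces, as the family of test spaces of the convenient category. -/
abbrev cgTest : CompHaus.{u} → Type u := fun S => S

/-- `Y` with the compactly generated topology attached to its given topology. -/
abbrev Kify (Y : Type u) [TopologicalSpace Y] : Type u :=
  WithGeneratedByTopology cgTest.{u} Y

/-- The class of spaces on which the test spaces determine the topology. -/
abbrev IsCG (Y : Type u) [TopologicalSpace Y] : Prop := IsGeneratedBy cgTest.{u} Y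

instance isCG_of_compactlyGenerated (Y : Type u) [TopologicalSpace Y]
    [CompactlyGeneratedSpace Y] : IsCG Y where
  continuous_equiv_symm := by
    refine continuous_from_uCompactlyGeneratedSpace.{u} _ fun S g => ?_
    exact (IsGeneratedBy.equiv_symm_comp_continuous_iff (X := cgTest.{u}) g).2 g.continuous

/-- Compact Hausdorff spaces are compactly generated. -/
theorem isCG_of_compactHausdorff (Y : Type u) [TopologicalSpace Y] [CompactSpace Y] [T2Space Y] :
    IsCG Y where
  continuous_equiv_symm := by
    rw [continuous_def]
    intro U hU
    rw [WithGeneratedByTopology.isOpen_iff] at hU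
    exact hU (i := CompHaus.of Y) ⟨fun y => y, continuous_id⟩

/-- The product of a compactly generated space with the unit interval is compactly generated. -/
instance isCG_prod_unitInterval (Y : Type u) [TopologicalSpace Y] [IsCG Y] : IsCG (Y × I) where
  continuous_equiv_symm := by
    let F : Y → C(I, Kify (Y × I)) := fun y =>
      { toFun := fun t => WithGeneratedByTopology.equiv.symm (y, t)
        continuous_toFun := by
          have hI : IsCG (ULift.{u} I) := isCG_of_compactHausdorff _
          have h : Continuous (fun t : ULift.{u} I =>
              (WithGeneratedByTopology.equiv (X := cgTest.{u})).symm (y, t.down)) :=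
            (IsGeneratedBy.equiv_symm_comp_continuous_iff (X := cgTest.{u})
              (fun t : ULift.{u} I => (y, t.down))).2 (by fun_prop)
          exact h.comp continuous_uliftUp }
    have hF : Continuous F := by
      rw [IsGeneratedBy.continuous_iff cgTest.{u}]
      intro S g
      have hSI : IsCG (S × I) := isCG_of_compactHausdorff _
      have h : Continuous (fun p : S × I =>
          (WithGeneratedByTopology.equiv (X := cgTest.{u})).symm (g p.1, p.2)) :=
        (IsGeneratedBy.equiv_symm_comp_continuous_iff (X := cgTest.{u})
          (fun p : S × I => (g p.1, p.2))).2 (by fun_prop)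
      exact (ContinuousMap.curry ⟨_, h⟩).continuous
    exact ContinuousMap.continuous_uncurry_of_continuous ⟨F, hF⟩

instance isCG_unitInterval_prod (Y : Type u) [TopologicalSpace Y] [IsCG Y] : IsCG (I × Y) :=
  (Homeomorph.prodComm Y I).isQuotientMap.isGeneratedBy

section Kify

variable {T Y Z : Type u} [TopologicalSpace T] [TopologicalSpace Y] [TopologicalSpace Z]

/-- A continuous map from a compactly generated space to `Y` is continuous into `Kify Y`. -/
def kLift [IsCG T] (f : C(T, Y)) : C(T, Kify Y) :=
  ⟨WithGeneratedByTopology.equiv.symm ∘ f,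
    (IsGeneratedBy.equiv_symm_comp_continuous_iff (X := cgTest.{u}) f).2 f.continuous⟩

/-- The identity, as a continuous map from `Kify Y` to `Y`. -/
def kOut (Y : Type u) [TopologicalSpace Y] : C(Kify Y, Y) :=
  ⟨WithGeneratedByTopology.equiv, WithGeneratedByTopology.continuous_equiv⟩

/-- A point of `Y`, as a point of `Kify Y`. -/
def kPt (y : Y) : Kify Y := WithGeneratedByTopology.equiv.symm y

end Kify

section Products

variable {T X Y Z X' Y' : Type u} [TopologicalSpace T] [TopologicalSpace X] [TopologicalSpace Y]
  [TopologicalSpace Z] [TopologicalSpace X'] [TopologicalSpace Y']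

/-- The product in the convenient category. -/
abbrev KProd (X Y : Type u) [TopologicalSpace X] [TopologicalSpace Y] : Type u := Kify (X × Y)

/-- The point `(x, y)` of the product. -/
def kpt (x : X) (y : Y) : KProd X Y := kPt (x, y)

def kFst : C(KProd X Y, X) := ContinuousMap.fst.comp (kOut (X × Y))

def kSnd : C(KProd X Y, Y) := ContinuousMap.snd.comp (kOut (X × Y))

/-- The map `t ↦ (f t, g t)`. -/
def kPair [IsCG T] (f : C(T, X)) (g : C(T, Y)) : C(T, KProd X Y) := kLift (f.prodMk g)

/-- The map `f × g`. -/
def kMap (f : C(X, X')) (g : C(Y, Y')) : C(KProd X Y, KProd X' Y') :=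
  kPair (f.comp kFst) (g.comp kSnd)

/-- The map `(x, (y, z)) ↦ ((x, y), z)`. -/
def kAssoc : C(KProd X (KProd Y Z), KProd (KProd X Y) Z) :=
  kPair (kPair kFst (kFst.comp kSnd)) (kSnd.comp kSnd)

end Products

/-! ### Smash products -/

section Smash

variable {X Y X' Y' : Type u} [TopologicalSpace X] [TopologicalSpace Y]
  [TopologicalSpace X'] [TopologicalSpace Y']

/-- The relation on the product that identifies all points of the wedge
`X × {y₀} ∪ {x₀} × Y` with one another. -/
def smashRel (x₀ : X) (y₀ : Y) (p q : KProd X Y) : Prop :=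
  (kFst p = x₀ ∨ kSnd p = y₀) ∧ (kFst q = x₀ ∨ kSnd q = y₀)

/-- The smash product of the based spaces `(X, x₀)` and `(Y, y₀)`, with the quotient topology. -/
abbrev Smash (x₀ : X) (y₀ : Y) : Type u := Quot (smashRel x₀ y₀)

/-- The quotient map from the product to the smash product. -/
def smashMk (x₀ : X) (y₀ : Y) : C(KProd X Y, Smash x₀ y₀) :=
  ⟨Quot.mk _, continuous_quot_mk⟩

/-- The base point of the smash product. -/
def smashPt (x₀ : X) (y₀ : Y) : Smash x₀ y₀ := smashMk x₀ y₀ (kpt x₀ y₀)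

/-- The map `f ∧ g` induced by based maps `f` and `g`. -/
def smashMap {x₀ : X} {y₀ : Y} {x₁ : X'} {y₁ : Y'} (f : C(X, X')) (g : C(Y, Y'))
    (hf : f x₀ = x₁) (hg : g y₀ = y₁) : C(Smash x₀ y₀, Smash x₁ y₁) where
  toFun := Quot.map (kMap f g) (by
    rintro p q ⟨hp, hq⟩
    refine ⟨hp.imp (fun h => ?_) (fun h => ?_), hq.imp (fun h => ?_) (fun h => ?_)⟩
    · exact (congrArg f h).trans hf
    · exact (congrArg g h).trans hg
    · exact (congrArg f h).trans hf
    · exact (congrArg g h).trans hg)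
  continuous_toFun := continuous_quot_lift _ (continuous_quot_mk.comp (kMap f g).continuous)

end Smash

/-! ### Based and free loop spaces -/

section Loops

variable {T Y Z : Type u} [TopologicalSpace T] [TopologicalSpace Y] [TopologicalSpace Z]

/-- The space of loops at `y`, with the compact-open topology made compactly generated. -/
abbrev BasedLoop (y : Y) : Type u := Kify (Path y y)

/-- The free loop space, with the compact-open topology made compactly generated. -/
abbrev FreeLoop (Y : Type u) [TopologicalSpace Y] : Type u := Kify {γ : C(I, Y) // γ 0 = γ 1}

/-- The constant loop at `y`, the base point of `BasedLoop y`. -/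
def basedConst (y : Y) : BasedLoop y := kPt (Path.refl y)

/-- The constant loop at `y`, as a free loop. -/
def freeConst (y : Y) : FreeLoop Y := kPt ⟨ContinuousMap.const I y, rfl⟩

/-- The evaluation `(γ, t) ↦ γ t`. -/
def freeEval (Y : Type u) [TopologicalSpace Y] : C(FreeLoop Y × I, Y) where
  toFun p := (kOut _ p.1).1 p.2
  continuous_toFun := by
    have h : Continuous fun p : FreeLoop Y × I => (kOut _ p.1).1 :=
      continuous_subtype_val.comp ((kOut _).continuous.comp continuous_fst)
    exact h.eval continuous_snd

/-- The map to the free loop space with adjoint `f`. -/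
def freeCurry [IsCG T] (f : C(T × I, Y)) (hf : ∀ x, f (x, 0) = f (x, 1)) : C(T, FreeLoop Y) :=
  kLift ⟨fun x => ⟨f.curry x, hf x⟩, f.curry.continuous.subtype_mk _⟩

/-- The evaluation map from the free loop space of `Y` to `Y`. -/
def freeProj (Y : Type u) [TopologicalSpace Y] : C(FreeLoop Y, Y) :=
  (freeEval Y).comp ((ContinuousMap.id _).prodMk (ContinuousMap.const _ 0))

/-- The section `y ↦ constant loop at y`. -/
def freeSection (Y : Type u) [TopologicalSpace Y] [IsCG Y] : C(Y, FreeLoop Y) :=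
  freeCurry ContinuousMap.fst fun _ => rfl

/-- The inclusion of the based loops in the free loops. -/
def loopIncl (y : Y) : C(BasedLoop y, FreeLoop Y) :=
  kLift ⟨fun p => ⟨(kOut (Path y y) p).toContinuousMap,
      (kOut (Path y y) p).source.trans (kOut (Path y y) p).target.symm⟩,
    (continuous_induced_dom.comp (kOut (Path y y)).continuous).subtype_mk _⟩

/-- The map of free loop spaces induced by `w`. -/
def freeMap (w : C(Y, Z)) : C(FreeLoop Y, FreeLoop Z) :=
  freeCurry (w.comp (freeEval Y)) fun x => congrArg w (kOut _ x).2

/-- The map of based loop spaces induced by a based map `w`. -/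
def basedMap (w : C(Y, Z)) {y : Y} {z : Z} (hw : w y = z) : C(BasedLoop y, BasedLoop z) :=
  kLift ⟨fun p => ((kOut (Path y y) p).map w.continuous).cast hw.symm hw.symm, by
    refine continuous_induced_rng.2 ?_
    exact (ContinuousMap.continuous_postcomp w).comp
      (continuous_induced_dom.comp (kOut (Path y y)).continuous)⟩

/-- Concatenation of based loops. -/
noncomputable def loopMul (y : Y) : C(KProd (BasedLoop y) (BasedLoop y), BasedLoop y) :=
  kLift ⟨fun p => (kOut (Path y y) (kFst p)).trans (kOut (Path y y) (kSnd p)),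
    Path.continuous_trans.comp (Continuous.prodMk
      (f := fun p : KProd (BasedLoop y) (BasedLoop y) => kOut (Path y y) (kFst p))
      (g := fun p : KProd (BasedLoop y) (BasedLoop y) => kOut (Path y y) (kSnd p))
      ((kOut (Path y y)).continuous.comp kFst.continuous)
      ((kOut (Path y y)).continuous.comp kSnd.continuous))⟩

/-- Reversal of based loops. -/
def loopInv (y : Y) : C(BasedLoop y, BasedLoop y) :=
  kLift ⟨fun p => (kOut (Path y y) p).symm,
    Path.continuous_symm.comp (kOut (Path y y)).continuous⟩

end Loops

/-! ### H-spaces -/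

/-- An H-space in the convenient category: a space with a base point `e` and a multiplication,
continuous on the compactly generated product, for which `e` is a two-sided unit up to based
homotopy. -/
structure KHSpace (Y : Type u) [TopologicalSpace Y] [IsCG Y] where
  e : Y
  mul : C(KProd Y Y, Y)
  one_mul : (mul.comp (kPair (ContinuousMap.const Y e) (ContinuousMap.id Y))).HomotopicRel
    (ContinuousMap.id Y) {e}
  mul_one : (mul.comp (kPair (ContinuousMap.id Y) (ContinuousMap.const Y e))).HomotopicRel
    (ContinuousMap.id Y) {e}

namespace KHSpace

variable {Y : Type u} [TopologicalSpace Y] [IsCG Y]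

/-- The multiplication is associative up to based homotopy. -/
def IsHomotopyAssoc (h : KHSpace Y) : Prop :=
  (h.mul.comp ((kMap h.mul (ContinuousMap.id Y)).comp kAssoc)).HomotopicRel
    (h.mul.comp (kMap (ContinuousMap.id Y) h.mul)) {kpt h.e (kpt h.e h.e)}

/-- Every path component has an inverse. For a homotopy-associative multiplication this says that
the monoid of path components is a group; it holds if the space is path connected. -/
def IsGrouplike (h : KHSpace Y) : Prop :=
  ∀ y : Y, ∃ z : Y, Joined (h.mul (kpt z y)) h.e

/-- The multiplication `(γ, δ) ↦ (t ↦ γ t * δ t)` of free loops. -/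
def freeMul (h : KHSpace Y) : C(KProd (FreeLoop Y) (FreeLoop Y), FreeLoop Y) :=
  freeCurry
    (h.mul.comp (kPair
      ((freeEval Y).comp (kFst.prodMap (ContinuousMap.id I)))
      ((freeEval Y).comp (kSnd.prodMap (ContinuousMap.id I)))))
    (fun x => congrArg h.mul (congrArg kPt (Prod.ext (kOut _ (kFst x)).2 (kOut _ (kSnd x)).2)))

/-- A homotopy relative to `{y}` acts pointwise on free loops. -/
theorem freeMap_homotopicRel {Y : Type u} [TopologicalSpace Y] {f g : C(Y, Y)} {y : Y} (H : f.HomotopicRel g {y}) :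
    (freeMap f).HomotopicRel (freeMap g) {freeConst y} := by
  obtain ⟨H⟩ := H
  refine ⟨⟨⟨freeCurry (T := I × FreeLoop Y)
    ⟨fun p => H (p.1.1, freeEval Y (p.1.2, p.2)), by fun_prop⟩
    (fun x => congrArg (fun z => H (x.1, z)) (kOut _ x.2).2), ?_, ?_⟩, ?_⟩⟩
  · intro γ
    exact congrArg kPt (Subtype.ext (ContinuousMap.ext fun t => H.apply_zero _))
  · intro γ
    exact congrArg kPt (Subtype.ext (ContinuousMap.ext fun t => H.apply_one _))
  · rintro t _ rfl
    exact congrArg kPt (Subtype.ext (ContinuousMap.ext fun s => H.eq_fst t rfl))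

/-- The free loop space of an H-space, with the pointwise multiplication. -/
def freeLoop (h : KHSpace Y) : KHSpace (FreeLoop Y) where
  e := freeConst h.e
  mul := h.freeMul
  one_mul := freeMap_homotopicRel h.one_mul
  mul_one := freeMap_homotopicRel h.mul_one

/-- The map from the product of the based loops with the space to the free loops that multiplies
the inclusion of the based loops with the section, `(γ, y) ↦ (t ↦ γ t * y)`. -/
def splitting (h : KHSpace Y) : C(KProd (BasedLoop h.e) Y, FreeLoop Y) :=
  h.freeLoop.mul.comp (kMap (loopIncl h.e) (freeSection Y))

/-- `D` is a deviation of the based map `f` from being an H-map: a based map on the smash product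
with `D (x ∧ y) * f (x * y)` and `f x * f y` based homotopic as maps of `(x, y)`. -/
def IsDeviation {X : Type u} [TopologicalSpace X] [IsCG X] (hX : KHSpace X) (hY : KHSpace Y)
    (f : C(X, Y)) (D : C(Smash hX.e hX.e, Y)) : Prop :=
  D (smashPt hX.e hX.e) = hY.e ∧
  (hY.mul.comp (kPair (D.comp (smashMk hX.e hX.e)) (f.comp hX.mul))).HomotopicRel
    (hY.mul.comp (kMap f f)) {kpt hX.e hX.e}

end KHSpace

/-! ### Point-set hypotheses -/

/-- `Y` has the homotopy type of a CW complex. -/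
def HasCWHomotopyType (Y : Type u) [TopologicalSpace Y] : Prop :=
  ∃ X : TopCat.{u}, Nonempty (TopCat.CWComplex X) ∧ Nonempty (ContinuousMap.HomotopyEquiv Y X)

/-- The point `y` is non-degenerate: the pair `(Y, {y})` is an NDR pair. -/
def IsNondegenerate {Y : Type u} [TopologicalSpace Y] (y : Y) : Prop :=
  ∃ (v : C(Y, I)) (F : C(I × Y, Y)),
    (∀ x, v x = 0 ↔ x = y) ∧ (∀ x, F (0, x) = x) ∧ (∀ t, F (t, y) = y) ∧
      ∀ x, v x < 1 → F (1, x) = y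

/-! ### The lifted deviation and the explicit composite -/

section Composite

variable {B C : Type u} [TopologicalSpace B] [TopologicalSpace C] [IsCG B] [IsCG C]

/-- `d` is a based lift, up to based homotopy, of the composite of the smash product of the
inclusion of the based loops and the section with the map `D`. -/
def IsLoopLift (hB : KHSpace B) (hC : KHSpace C)
    (D : C(Smash hB.freeLoop.e hB.freeLoop.e, FreeLoop C))
    (d : C(Smash (basedConst hB.e) hB.e, BasedLoop hC.e)) : Prop :=
  d (smashPt (basedConst hB.e) hB.e) = basedConst hC.e ∧
  ((loopIncl hC.e).comp d).HomotopicRel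
    (D.comp (smashMap (loopIncl hB.e) (freeSection B) rfl rfl))
    {smashPt (basedConst hB.e) hB.e}

/-- The composite
`ΩB × B → (ΩB ∧ B) × (ΩB × B) → ΩC × (ΩC × C) → (ΩC × ΩC) × C → ΩC × C → LC`
of `s × 1` (the quotient map paired with the identity), `E × Ωw × w`, reassociation, loop
multiplication, and the splitting. -/
noncomputable def explicitComposite (hB : KHSpace B) (hC : KHSpace C) (w : C(B, C)) (hw : w hB.e = hC.e)
    (E : C(Smash (basedConst hB.e) hB.e, BasedLoop hC.e)) :
    C(KProd (BasedLoop hB.e) B, FreeLoop C) :=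
  hC.splitting.comp <|
    (kMap (loopMul hC.e) (ContinuousMap.id C)).comp <|
      kAssoc.comp <|
        (kMap E (kMap (basedMap w hw) w)).comp <|
          kPair (smashMk (basedConst hB.e) hB.e) (ContinuousMap.id _)

end Composite

end ConvenientHSpaces

open ConvenientHSpaces

set_option linter.unusedSectionVars false

/-! Inverses in C. Left translations of a grouplike homotopy-associative H-space are homotopy
equivalences. Hence the space of triples (b, y, path from b·y to the unit), projected to b, has the
right lifting property against disk boundary inclusions (`exists_disk_lift`). A lift over a CW model
of C gives a right inverse up to free homotopy, and non-degeneracy of the base point makes it based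
(`exists_isRightInverse`). So the relative homotopy classes of maps into C (`HClass`) form groups.

Existence. In the group of based classes B × B → C, the quotient of w(x)·w(y) by w(xy) is trivial on
both axes, so it deforms to a map that is constant on the wedge (`exists_isDeviation`). Applied
pointwise in the loop variable, this deviation of w becomes a deviation of Lw; no inverses in LC are
needed.

Lifting. A based loop starts at the unit, so at time 0 the deviation relation on ΩB × B reads D(γ ∧
y)(0)·w(y) ≃ w(y). Cancelling w(y) makes the initial points of D null-homotopic on ΩB × B, and
`homotopicRel_const_of_smashMk` carries this down to ΩB ∧ B. Conjugating by the tracks of the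
null-homotopy turns free loops into based ones (`exists_basedLoop_lift`).

Formula. Restricted to ΩB × B, the deviation relation is δ·(Lw ∘ θ) = Ωw·w in the monoid of classes
into LC. The pointwise product of based loops is homotopic to their concatenation
(`freeMul_loopIncl_homotopicRel_loopMul`), so loop reversal gives a left inverse of δ. Multiplying
by it and reassociating yields the explicit composite (`freeMap_splitting_homotopicRel`). -/

namespace ConvenientHSpaces

open ContinuousMap

/-! ### Relative homotopies. -/

section HomotopicRel

variable {T T' Y Y' : Type*} [TopologicalSpace T] [TopologicalSpace T'] [TopologicalSpace Y]
  [TopologicalSpace Y']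

theorem homotopicRel_iff {f g : C(T, Y)} {S : Set T} : f.HomotopicRel g S ↔
    ∃ H : C(I × T, Y), (∀ x, H (0, x) = f x) ∧ (∀ x, H (1, x) = g x) ∧
      ∀ t, ∀ x ∈ S, H (t, x) = f x := by
  constructor
  · rintro ⟨H⟩
    exact ⟨H.toContinuousMap, H.apply_zero, H.apply_one, fun t x hx => H.eq_fst t hx⟩
  · rintro ⟨H, h0, h1, hS⟩
    exact ⟨⟨⟨H, h0, h1⟩, hS⟩⟩

theorem homotopicRel_precomp {f g : C(T, Y)} {S : Set T} {S' : Set T'} (h : f.HomotopicRel g S)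
    (k : C(T', T)) (hk : Set.MapsTo k S' S) : (f.comp k).HomotopicRel (g.comp k) S' := by
  obtain ⟨H, h0, h1, hS⟩ := homotopicRel_iff.1 h
  exact homotopicRel_iff.2 ⟨H.comp ((ContinuousMap.id I).prodMap k), fun x => h0 _, fun x => h1 _,
    fun t x hx => hS t _ (hk hx)⟩

theorem homotopicRel_postcomp {f g : C(T, Y)} {S : Set T} (h : f.HomotopicRel g S)
    (k : C(Y, Y')) : (k.comp f).HomotopicRel (k.comp g) S := by
  obtain ⟨H, h0, h1, hS⟩ := homotopicRel_iff.1 h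
  exact homotopicRel_iff.2 ⟨k.comp H, fun x => congrArg k (h0 x), fun x => congrArg k (h1 x),
    fun t x hx => congrArg k (hS t x hx)⟩

theorem homotopicRel_mono {f g : C(T, Y)} {S S' : Set T} (h : f.HomotopicRel g S) (hS : S' ⊆ S) :
    f.HomotopicRel g S' :=
  homotopicRel_precomp h (ContinuousMap.id T) hS

end HomotopicRel

/-! ### The monoid of relative homotopy classes of maps into an H-space. -/

namespace KHSpace

variable {Y : Type u} [TopologicalSpace Y] [IsCG Y] (h : KHSpace Y)

theorem mul_e_e : h.mul (kpt h.e h.e) = h.e := by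
  obtain ⟨H, h0, h1, hS⟩ := homotopicRel_iff.1 h.one_mul
  exact ((hS 1 _ rfl).symm.trans (h1 _))

variable {T T' : Type u} [TopologicalSpace T] [TopologicalSpace T'] [IsCG T] [IsCG T']

/-- The pointwise product of two maps to an H-space. -/
def pmul (f g : C(T, Y)) : C(T, Y) := h.mul.comp (kPair f g)

theorem pmul_homotopicRel {f f' g g' : C(T, Y)} {S : Set T} (hf : f.HomotopicRel f' S)
    (hg : g.HomotopicRel g' S) : (h.pmul f g).HomotopicRel (h.pmul f' g') S := by
  obtain ⟨F, h0, h1, hS⟩ := homotopicRel_iff.1 hf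
  obtain ⟨G, h0', h1', hS'⟩ := homotopicRel_iff.1 hg
  refine homotopicRel_iff.2 ⟨h.mul.comp (kPair F G), fun x => ?_, fun x => ?_, fun t x hx => ?_⟩
  · exact congrArg h.mul (congrArg₂ kpt (h0 x) (h0' x))
  · exact congrArg h.mul (congrArg₂ kpt (h1 x) (h1' x))
  · exact congrArg h.mul (congrArg₂ kpt (hS t x hx) (hS' t x hx))

/-- The maps to an H-space that send `S` to the unit. -/
abbrev RelMap (T : Type u) [TopologicalSpace T] (S : Set T) : Type u :=
  {f : C(T, Y) // ∀ x ∈ S, f x = h.e}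

instance relMapSetoid (S : Set T) : Setoid (h.RelMap T S) where
  r f g := f.1.HomotopicRel g.1 S
  iseqv := ⟨fun f => .refl f.1, fun hfg => hfg.symm, fun hfg hgk => hfg.trans hgk⟩

/-- The homotopy classes relative to `S` of maps to an H-space that send `S` to the unit. -/
def HClass (S : Set T) : Type u := Quotient (h.relMapSetoid S)

variable {h}

namespace HClass

variable {S : Set T} {S' : Set T'}

/-- The class of a map. -/
def mk (f : C(T, Y)) (hf : ∀ x ∈ S, f x = h.e) : h.HClass S := Quotient.mk _ ⟨f, hf⟩

theorem mk_eq_mk {f g : C(T, Y)} {hf : ∀ x ∈ S, f x = h.e} {hg : ∀ x ∈ S, g x = h.e} :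
    (mk f hf = mk g hg) ↔ f.HomotopicRel g S := Quotient.eq

theorem exists_mk (a : h.HClass S) : ∃ f hf, a = mk f hf := by
  obtain ⟨⟨f, hf⟩, rfl⟩ := Quotient.exists_rep a
  exact ⟨f, hf, rfl⟩

theorem pmul_mem {f g : C(T, Y)} (hf : ∀ x ∈ S, f x = h.e) (hg : ∀ x ∈ S, g x = h.e) :
    ∀ x ∈ S, h.pmul f g x = h.e := fun x hx =>
  (congrArg h.mul (congrArg₂ kpt (hf x hx) (hg x hx))).trans h.mul_e_e

instance : Mul (h.HClass S) where
  mul := Quotient.map₂ (fun f g => ⟨h.pmul f.1 g.1, pmul_mem f.2 g.2⟩)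
    fun _ _ hf _ _ hg => h.pmul_homotopicRel hf hg

instance : One (h.HClass S) where
  one := mk (ContinuousMap.const T h.e) fun _ _ => rfl

instance [ha : Fact h.IsHomotopyAssoc] : Monoid (h.HClass S) where
  one_mul a := by
    obtain ⟨f, hf, rfl⟩ := exists_mk a
    exact mk_eq_mk.2 (homotopicRel_precomp h.one_mul f hf)
  mul_one a := by
    obtain ⟨f, hf, rfl⟩ := exists_mk a
    exact mk_eq_mk.2 (homotopicRel_precomp h.mul_one f hf)
  mul_assoc a b c := by
    obtain ⟨f, hf, rfl⟩ := exists_mk a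
    obtain ⟨g, hg, rfl⟩ := exists_mk b
    obtain ⟨k, hk, rfl⟩ := exists_mk c
    exact mk_eq_mk.2 (homotopicRel_precomp ha.out (kPair f (kPair g k)) fun x hx =>
      congrArg₂ kpt (hf x hx) (congrArg₂ kpt (hg x hx) (hk x hx)))

/-- Precomposition with a map of pairs. -/
def comap (k : C(T', T)) (hk : Set.MapsTo k S' S) : h.HClass S → h.HClass S' :=
  Quotient.map (fun f => ⟨f.1.comp k, fun _ hx => f.2 _ (hk hx)⟩)
    fun _ _ hf => homotopicRel_precomp hf k hk

theorem comap_mul (k : C(T', T)) (hk : Set.MapsTo k S' S) (a b : h.HClass S) :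
    comap k hk (a * b) = comap k hk a * comap k hk b := by
  obtain ⟨f, hf, rfl⟩ := exists_mk a
  obtain ⟨g, hg, rfl⟩ := exists_mk b
  rfl

end HClass

end KHSpace

/-- In a monoid in which every element has a right inverse, every element is a unit. -/
theorem isUnit_of_forall_exists_mul_eq_one {M : Type*} [Monoid M] (H : ∀ a : M, ∃ b, a * b = 1)
    (a : M) : IsUnit a := by
  obtain ⟨b, hb⟩ := H a
  obtain ⟨c, hc⟩ := H b
  have : a = c := by rw [← mul_one a, ← hc, ← mul_assoc, hb, one_mul]
  exact ⟨⟨a, b, hb, this ▸ hc⟩, rfl⟩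

/-! ### Homotopy fibers of homotopy equivalences. -/

section HomotopyFiber

variable {M M' : Type*} [TopologicalSpace M] [TopologicalSpace M']

/-- The homotopy fiber of `L` over `e`. -/
abbrev HFiber (L : C(M, M')) (e : M') : Type _ :=
  {p : M × C(I, M') // p.2 0 = L p.1 ∧ p.2 1 = e}

/-- The point of the homotopy fiber given by a point `y` and a path from `L y` to `e`. -/
def HFiber.mk {L : C(M, M')} {e : M'} (y : M) (γ : Path (L y) e) : HFiber L e :=
  ⟨(y, γ.toContinuousMap), γ.source, γ.target⟩

theorem HFiber.joined_of_homotopic {L : C(M, M')} {e : M'} {y : M} {γ γ' : Path (L y) e}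
    (hγ : γ.Homotopic γ') : Joined (HFiber.mk y γ) (HFiber.mk y γ') := by
  obtain ⟨F⟩ := hγ
  refine ⟨⟨⟨fun s => ⟨(y, F.toContinuousMap.curry s), F.source s, F.target s⟩, by fun_prop⟩,
    ?_, ?_⟩⟩
  · refine Subtype.ext (Prod.ext rfl (ContinuousMap.ext fun t => F.apply_zero t))
  · refine Subtype.ext (Prod.ext rfl (ContinuousMap.ext fun t => F.apply_one t))

/-- The point of `M` travels along `p`. At time `s` the part of `p` already covered is cut from the
path in `M'` and replaced by waiting at `L (p s)`, which is the effect of `max s (2 * t)`. -/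
theorem HFiber.joined_trans {L : C(M, M')} {e : M'} {y y' : M} (p : Path y y')
    (γ : Path (L y') e) : Joined (HFiber.mk y ((p.map L.continuous).trans γ))
      (HFiber.mk y' ((Path.refl (L y')).trans γ)) := by
  let G : C(I × I, M') :=
    { toFun := fun q => if (q.2 : ℝ) ≤ 1 / 2 then L (p.extend (max (q.1 : ℝ) (2 * q.2)))
        else γ.extend (2 * q.2 - 1)
      continuous_toFun := by
        refine Continuous.if_le (by fun_prop) (by fun_prop) (by fun_prop) (by fun_prop) ?_
        intro q hq
        rw [hq, p.extend_of_one_le (by norm_num), γ.extend_of_le_zero (by norm_num)] }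
  refine ⟨⟨⟨fun s => ⟨(p s, G.curry s), ?_, ?_⟩, by fun_prop⟩, ?_, ?_⟩⟩
  · change (if ((0 : I) : ℝ) ≤ 1 / 2 then _ else _) = _
    rw [if_pos (by norm_num)]
    simp [max_eq_left s.2.1]
  · change (if ((1 : I) : ℝ) ≤ 1 / 2 then _ else _) = _
    rw [if_neg (by norm_num)]
    simp only [Set.Icc.coe_one, mul_one]
    exact γ.extend_of_one_le (by norm_num)
  · refine Subtype.ext (Prod.ext p.source (ContinuousMap.ext fun t => ?_))
    change (if (t : ℝ) ≤ 1 / 2 then _ else _) = Path.trans _ _ t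
    rw [Path.trans_apply]
    split_ifs with ht
    · have : max ((0 : I) : ℝ) (2 * t) = 2 * t := max_eq_right (by simpa using t.2.1)
      change L (p.extend (max ((0 : I) : ℝ) (2 * t))) = L (p _)
      rw [this, ← Path.extend_apply]
    · rw [← Path.extend_apply]
  · refine Subtype.ext (Prod.ext p.target (ContinuousMap.ext fun t => ?_))
    change (if (t : ℝ) ≤ 1 / 2 then _ else _) = Path.trans _ _ t
    rw [Path.trans_apply]
    split_ifs with ht
    · exact congrArg L (p.extend_of_one_le (le_max_left _ _))
    · rw [← Path.extend_apply]

/-- The homotopy fibers of a homotopy equivalence are path connected. -/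
theorem HFiber.joined (L : ContinuousMap.HomotopyEquiv M M') {e : M'} (a b : HFiber L.toFun e) : Joined a b := by
  obtain ⟨⟨y, γ⟩, h0, h1⟩ := a
  obtain ⟨⟨y', γ'⟩, h0', h1'⟩ := b
  let γ₁ : Path (L.toFun y) e := ⟨γ, h0, h1⟩
  let γ₂ : Path (L.toFun y') e := ⟨γ', h0', h1'⟩
  change Joined (HFiber.mk y γ₁) (HFiber.mk y' γ₂)
  -- Fullness on fundamental groupoids supplies a path `p` whose image is homotopic to `γ₁` followed
  -- by the reverse of `γ₂`. Faithfulness is not needed for path connectedness.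
  have hfull : (FundamentalGroupoid.map L.toFun).Full :=
    inferInstanceAs (FundamentalGroupoidFunctor.equivOfHomotopyEquiv L).functor.Full
  obtain ⟨q, hq⟩ := hfull.map_surjective (X := ⟨y⟩) (Y := ⟨y'⟩)
    (Path.Homotopic.Quotient.mk (γ₁.trans γ₂.symm))
  obtain ⟨p, rfl⟩ := Path.Homotopic.Quotient.mk_surjective q
  have hp : (p.map L.toFun.continuous).Homotopic (γ₁.trans γ₂.symm) := Quotient.exact hq
  have h : ((p.map L.toFun.continuous).trans γ₂).Homotopic γ₁ := by
    rw [← Path.Homotopic.Quotient.eq] at hp ⊢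
    simp [hp]
  exact ((HFiber.joined_of_homotopic h.symm).trans (HFiber.joined_trans p γ₂)).trans
    (HFiber.joined_of_homotopic (Path.Homotopic.refl_trans γ₂))

end HomotopyFiber

/-! ### Mapping spaces out of a compact space, and fiberwise operations on them. -/

/-- The product of a compactly generated space with a compact Hausdorff space is compactly
generated. -/
theorem isCG_prod_compactHausdorff (Y : Type u) [TopologicalSpace Y] [IsCG Y] (K : Type u)
    [TopologicalSpace K] [CompactSpace K] [T2Space K] : IsCG (Y × K) where
  continuous_equiv_symm := by
    have hK : IsCG K := isCG_of_compactHausdorff K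
    let F : Y → C(K, Kify (Y × K)) := fun y =>
      kLift ((ContinuousMap.const K y).prodMk (ContinuousMap.id K))
    have hF : Continuous F := by
      rw [IsGeneratedBy.continuous_iff cgTest.{u}]
      intro S g
      have hSK : IsCG (S × K) := isCG_of_compactHausdorff _
      exact (ContinuousMap.curry (kLift (T := S × K) (g.prodMap (ContinuousMap.id K)))).continuous
    exact ContinuousMap.continuous_uncurry_of_continuous ⟨F, hF⟩

theorem isGeneratedBy_unitInterval : IsGeneratedBy cgTest.{u} I :=
  have : IsCG (ULift.{u} I) := isCG_of_compactHausdorff _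
  Homeomorph.ulift.{u}.isQuotientMap.isGeneratedBy

section FiberwiseMaps

variable {C : Type u} [TopologicalSpace C] [IsCG C] {K : Type u} [TopologicalSpace K]
  [CompactSpace K] [T2Space K]

/-- The operation `y ↦ (s ↦ Φ (s, y s))` on maps `K → C`. -/
def fiberwise (Φ : C(KProd K C, C)) : C(Kify C(K, C), Kify C(K, C)) :=
  have : IsCG (Kify C(K, C) × K) := isCG_prod_compactHausdorff _ _
  kLift (ContinuousMap.curry (Φ.comp (kPair (T := Kify C(K, C) × K) ContinuousMap.snd
    ⟨fun q => kOut C(K, C) q.1 q.2,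
      Continuous.eval ((kOut _).continuous.comp continuous_fst) continuous_snd⟩)))

theorem fiberwise_homotopic {Φ Ψ : C(KProd K C, C)} (hΦ : Φ.HomotopicRel Ψ ∅) :
    (fiberwise Φ).Homotopic (fiberwise Ψ) := by
  obtain ⟨H, h0, h1, -⟩ := homotopicRel_iff.1 hΦ
  have : IsCG ((I × Kify C(K, C)) × K) := isCG_prod_compactHausdorff _ _
  let G : C((I × Kify C(K, C)) × K, C) := H.comp
    ((ContinuousMap.fst.comp ContinuousMap.fst).prodMk
      (kPair ContinuousMap.snd ⟨fun q => kOut C(K, C) q.1.2 q.2,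
        Continuous.eval ((kOut _).continuous.comp (continuous_snd.comp continuous_fst))
          continuous_snd⟩))
  exact ⟨⟨kLift G.curry, fun y => congrArg kPt (ContinuousMap.ext fun s => h0 _),
    fun y => congrArg kPt (ContinuousMap.ext fun s => h1 _)⟩⟩

theorem fiberwise_comp [IsCG K] (Φ Ψ : C(KProd K C, C)) :
    (fiberwise Φ).comp (fiberwise Ψ) = fiberwise (Φ.comp (kPair kFst Ψ)) := rfl

theorem fiberwise_kSnd : fiberwise (kSnd : C(KProd K C, C)) = ContinuousMap.id _ := rfl

end FiberwiseMaps

/-! ### The space of inverses over C and its vertical homotopies. -/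

namespace KHSpace

variable {C : Type u} [TopologicalSpace C] [IsCG C] (h : KHSpace C)

/-- The space of triples of two points `b`, `y` and a path from `b * y` to the unit. -/
abbrev InvSpace : Type u := HFiber h.mul h.e

/-- The projection `(b, y, γ) ↦ b`. -/
def invProj : C(h.InvSpace, C) :=
  ⟨fun a => kFst a.1.1, by fun_prop⟩

/-- The projection `(b, y, γ) ↦ y`. -/
def invSnd : C(h.InvSpace, C) :=
  ⟨fun a => kSnd a.1.1, by fun_prop⟩

/-- The evaluation `((b, y, γ), t) ↦ γ t`. -/
def invEval : C(h.InvSpace × I, C) :=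
  ⟨fun a => a.1.1.2 a.2, by fun_prop⟩

variable {h}

theorem invEval_zero (a : h.InvSpace) : h.invEval (a, 0) = h.mul (kpt (h.invProj a) (h.invSnd a)) :=
  a.2.1

theorem invEval_one (a : h.InvSpace) : h.invEval (a, 1) = h.e := a.2.2

theorem invSpace_ext {a b : h.InvSpace} (h1 : h.invProj a = h.invProj b)
    (h2 : h.invSnd a = h.invSnd b) (h3 : ∀ t, h.invEval (a, t) = h.invEval (b, t)) : a = b :=
  Subtype.ext (Prod.ext (congrArg₂ kpt h1 h2) (ContinuousMap.ext h3))

variable {T : Type u} [TopologicalSpace T] [IsCG T]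

/-- The map to `InvSpace` with the given components. -/
def invMk (f y : C(T, C)) (γ : C(T × I, C)) (h0 : ∀ x, γ (x, 0) = h.mul (kpt (f x) (y x)))
    (h1 : ∀ x, γ (x, 1) = h.e) : C(T, h.InvSpace) :=
  ⟨fun x => ⟨(kPair f y x, γ.curry x), h0 x, h1 x⟩, by fun_prop⟩

/-- Homotopy lifting for `invProj`, over a time `l x` that depends on the point. The second
component `y` is kept. The new path first runs through `g (x, t) * y` up to time `l x`, then through
the old path compressed into the remaining time. The bound on `l` keeps the denominator `1 - l x`
away from zero. -/
theorem exists_invSpace_transport (V : C(T, h.InvSpace)) (g : C(T × I, C)) (l : C(T, I))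
    (hl : ∀ x, (l x : ℝ) ≤ 1 / 2) (hV : ∀ x, h.invProj (V x) = g (x, l x)) :
    ∃ W : C(T, h.InvSpace), (∀ x, h.invProj (W x) = g (x, 0)) ∧ ∀ x, l x = 0 → W x = V x := by
  let y : C(T, C) := h.invSnd.comp V
  let γ : C(T × I, C) :=
    { toFun := fun q => if (q.2 : ℝ) ≤ l q.1 then
          h.mul (kPair (T := T × I) g (y.comp ContinuousMap.fst) q)
        else h.invEval (V q.1, Set.projIcc 0 1 zero_le_one ((q.2 - l q.1) / (1 - l q.1)))
      continuous_toFun := by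
        have hne : ∀ q : T × I, (1 : ℝ) - l q.1 ≠ 0 := fun q => by linarith [hl q.1]
        refine Continuous.if_le (by fun_prop) ?_ (by fun_prop) (by fun_prop) ?_
        · refine h.invEval.continuous.comp (Continuous.prodMk (by fun_prop)
            (continuous_projIcc.comp (Continuous.div (by fun_prop) (by fun_prop) hne)))
        · intro q hq
          have hq' : q.2 = l q.1 := Subtype.ext hq
          rw [hq, sub_self, zero_div, Set.projIcc_left]
          change h.mul (kpt (g q) (y q.1)) = h.invEval (V q.1, 0)
          rw [invEval_zero, hV, ← hq']
          rfl }
  refine ⟨invMk (g.comp ((ContinuousMap.id T).prodMk (ContinuousMap.const T 0))) y γ ?_ ?_, ?_, ?_⟩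
  · intro x
    exact if_pos (l x).2.1
  · intro x
    change (if ((1 : I) : ℝ) ≤ l x then _ else _) = _
    have hlt : ¬ ((1 : I) : ℝ) ≤ l x := by
      rw [Set.Icc.coe_one]
      linarith [hl x]
    rw [if_neg hlt, Set.Icc.coe_one, div_self (by linarith [hl x]), Set.projIcc_right]
    exact invEval_one _
  · intro x
    rfl
  · intro x hx
    refine invSpace_ext ((congrArg (fun t => g (x, t)) hx.symm).trans (hV x).symm) rfl fun t => ?_
    change (if (t : ℝ) ≤ l x then _ else _) = _
    split_ifs with ht
    · have ht0 : t = 0 := le_antisymm (Subtype.coe_le_coe.1 (hx ▸ ht)) t.2.1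
      subst ht0
      rw [invEval_zero, hV x, hx]
      rfl
    · simp [hx]

variable {K : Type u} [TopologicalSpace K] [CompactSpace K] [T2Space K] [IsCG K]

/-- A lift of `b` to `InvSpace` is a point of the homotopy fiber of left translation by `b` on the
mapping space `C(K, C)`. Since `b` is a unit, this translation is a homotopy equivalence, so its
homotopy fiber is path connected; a path in it is a vertical homotopy. -/
theorem exists_invSpace_homotopy [Fact h.IsHomotopyAssoc] (u v : C(K, h.InvSpace)) (b : C(K, C))
    (hb : IsUnit (HClass.mk b (by simp) : h.HClass ∅))
    (hu : ∀ s, h.invProj (u s) = b s) (hv : ∀ s, h.invProj (v s) = b s) :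
    ∃ J : C(I × K, h.InvSpace), (∀ s, J (0, s) = u s) ∧ (∀ s, J (1, s) = v s) ∧
      ∀ t s, h.invProj (J (t, s)) = b s := by
  have hgenI := isGeneratedBy_unitInterval.{u}
  obtain ⟨c, hcb, hbc⟩ := isUnit_iff_exists.1 hb
  obtain ⟨b', hb', rfl⟩ := HClass.exists_mk c
  let Φ : C(K, C) → C(KProd K C, C) := fun β => h.pmul (β.comp kFst) kSnd
  have key : ∀ β β' : C(K, C), (HClass.mk β (by simp) * HClass.mk β' (by simp) : h.HClass ∅) = 1 →
      ((fiberwise (Φ β)).comp (fiberwise (Φ β'))).Homotopic (ContinuousMap.id _) := by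
    intro β β' hβ
    rw [fiberwise_comp, ← fiberwise_kSnd]
    refine fiberwise_homotopic ((HClass.mk_eq_mk (h := h) (hf := by simp) (hg := by simp)).1 ?_)
    -- The relation `β * β' = 1` is pulled back to `K × C` and multiplied on the right by the
    -- projection to `C`.
    have h2 := congrArg (HClass.comap (kFst : C(KProd K C, K)) (Set.mapsTo_empty _ _)) hβ
    calc HClass.mk ((Φ β).comp (kPair kFst (Φ β'))) _
        = HClass.mk (β.comp kFst) (by simp) * (HClass.mk (β'.comp kFst) (by simp)
            * HClass.mk kSnd (by simp)) := rfl
      _ = _ := by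
        rw [← mul_assoc]
        exact (congrArg (· * HClass.mk kSnd (by simp)) h2).trans (_root_.one_mul _)
  let L : ContinuousMap.HomotopyEquiv (Kify C(K, C)) (Kify C(K, C)) :=
    ⟨fiberwise (Φ b), fiberwise (Φ b'), key _ _ hbc, key _ _ hcb⟩
  have lift : ∀ w : C(K, h.InvSpace), (∀ s, h.invProj (w s) = b s) →
      ∃ a : HFiber L.toFun (kPt (ContinuousMap.const K h.e)),
        a.1.1 = kPt (h.invSnd.comp w) ∧ ∀ t s, kOut _ (a.1.2 t) s = h.invEval (w s, t) := by
    intro w hw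
    let G : C(I × K, C) := h.invEval.comp ((w.comp ContinuousMap.snd).prodMk ContinuousMap.fst)
    refine ⟨⟨(kPt (h.invSnd.comp w), ⟨fun t => kPt (G.curry t),
      (IsGeneratedBy.equiv_symm_comp_continuous_iff (X := cgTest.{u}) _).2 G.curry.continuous⟩),
      ?_, ?_⟩, rfl, fun t s => rfl⟩
    · refine congrArg kPt (ContinuousMap.ext fun s => (invEval_zero (w s)).trans ?_)
      rw [hw s]
      rfl
    · exact congrArg kPt (ContinuousMap.ext fun s => invEval_one (w s))
  obtain ⟨a, ha, ha'⟩ := lift u hu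
  obtain ⟨a₁, ha₁, ha₁'⟩ := lift v hv
  obtain ⟨q⟩ := HFiber.joined L a a₁
  have hq1 : Continuous fun t => kOut C(K, C) (q t).1.1 := by fun_prop
  have hq2 : Continuous fun t : I × I => kOut C(K, C) ((q t.1).1.2 t.2) := by fun_prop
  let y : C(I × K, C) := ⟨fun z => kOut C(K, C) (q z.1).1.1 z.2,
    Continuous.eval (hq1.comp continuous_fst) continuous_snd⟩
  let γ : C((I × K) × I, C) := ⟨fun z => kOut C(K, C) ((q z.1.1).1.2 z.2) z.1.2,
    Continuous.eval (hq2.comp (by fun_prop : Continuous fun z : (I × K) × I => (z.1.1, z.2)))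
      (by fun_prop)⟩
  refine ⟨invMk (b.comp ContinuousMap.snd) y γ ?_ ?_, ?_, ?_, fun t s => rfl⟩
  · intro z
    exact congrArg (fun c : Kify C(K, C) => kOut C(K, C) c z.2) (q z.1).2.1
  · intro z
    exact congrArg (fun c : Kify C(K, C) => kOut C(K, C) c z.2) (q z.1).2.2
  · intro s
    refine invSpace_ext (hu s).symm ?_ fun t => ?_
    · change kOut C(K, C) (q 0).1.1 s = _
      rw [q.source, ha]
      rfl
    · change kOut C(K, C) ((q 0).1.2 t) s = _
      rw [q.source, ha']
  · intro s
    refine invSpace_ext (hv s).symm ?_ fun t => ?_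
    · change kOut C(K, C) (q 1).1.1 s = _
      rw [q.target, ha₁]
      rfl
    · change kOut C(K, C) ((q 1).1.2 t) s = _
      rw [q.target, ha₁']

end KHSpace

/-! ### Lifting over disks and CW complexes; the free right inverse. -/

section CWComplexes

open CategoryTheory

namespace KHSpace

variable {C : Type u} [TopologicalSpace C] [IsCG C] {h : KHSpace C} {T : Type u}
  [TopologicalSpace T] [IsCG T]

/-- In a grouplike H-space every null-homotopic map represents a unit. -/
theorem isUnit_mk_of_homotopic_const [Fact h.IsHomotopyAssoc] (hg : h.IsGrouplike) (f : C(T, C))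
    (c : C) (hf : f.HomotopicRel (ContinuousMap.const T c) ∅) :
    IsUnit (HClass.mk f (by simp) : h.HClass ∅) := by
  have hc : ∀ c : C, IsUnit (HClass.mk (ContinuousMap.const T c) (by simp) : h.HClass ∅) := by
    have hleft : ∀ c : C, ∃ z : C, (HClass.mk (ContinuousMap.const T z) (by simp) *
        HClass.mk (ContinuousMap.const T c) (by simp) : h.HClass ∅) = 1 := by
      intro c
      obtain ⟨z, ⟨p⟩⟩ := hg c
      refine ⟨z, HClass.mk_eq_mk.2 (homotopicRel_iff.2
        ⟨p.toContinuousMap.comp ContinuousMap.fst, fun x => p.source, fun x => p.target, ?_⟩)⟩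
      simp
    intro c
    obtain ⟨z, hz⟩ := hleft c
    -- `z` is a left inverse of `c` and `y` one of `z`, so `y` and `c` agree as classes and `z` is
    -- two-sided.
    obtain ⟨y, hy⟩ := hleft z
    have hyc : (HClass.mk (ContinuousMap.const T y) (by simp) : h.HClass ∅) =
        HClass.mk (ContinuousMap.const T c) (by simp) := left_inv_eq_right_inv hy hz
    exact isUnit_iff_exists.2 ⟨_, hyc ▸ hy, hz⟩
  rw [HClass.mk_eq_mk (hg := by simp) |>.2 hf]
  exact hc c

section Disk

open TopCat

/-- The radial stretch of the disk by a factor of at most two. -/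
noncomputable def diskStretch (n : ℕ) : C((𝔻 n : TopCat.{u}) × I, (𝔻 n : TopCat.{u})) where
  toFun q := ⟨⟨(min (max ‖q.1.down.1‖ (1 / 2))⁻¹ (1 + 4 * q.2)) • q.1.down.1, by
    have h0 : 0 ≤ ‖q.1.down.1‖ := norm_nonneg _
    have hm : 0 < max ‖q.1.down.1‖ (1 / 2) := lt_max_of_lt_right (by norm_num)
    have h2 := q.2.2.1
    rw [mem_closedBall_zero_iff, norm_smul, Real.norm_of_nonneg (le_min (by positivity)
      (by positivity))]
    calc _ ≤ (max ‖q.1.down.1‖ (1 / 2))⁻¹ * max ‖q.1.down.1‖ (1 / 2) := by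
          gcongr
          · exact min_le_left _ _
          · exact le_max_left _ _
      _ = 1 := inv_mul_cancel₀ hm.ne'⟩⟩
  continuous_toFun := by
    have hd : Continuous fun q : (𝔻 n : TopCat.{u}) × I => q.1.down.1 :=
      continuous_subtype_val.comp (continuous_uliftDown.comp continuous_fst)
    have hm : ∀ q : (𝔻 n : TopCat.{u}) × I, max ‖q.1.down.1‖ (1 / 2) ≠ 0 := fun q =>
      (lt_max_of_lt_right (by norm_num)).ne'
    refine continuous_uliftUp.comp (Continuous.subtype_mk (Continuous.smul (Continuous.min
      (Continuous.inv₀ (hd.norm.max continuous_const) hm) (by fun_prop)) hd) _)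

/-- Half the distance of a point of the disk from the boundary. -/
noncomputable def diskDepth (n : ℕ) : C((𝔻 n : TopCat.{u}), I) where
  toFun d := ⟨(1 - ‖d.down.1‖) / 2, by
    have h1 := mem_closedBall_zero_iff.1 d.down.2
    have h0 : 0 ≤ ‖d.down.1‖ := norm_nonneg _
    constructor <;> linarith⟩
  continuous_toFun := by
    have hd : Continuous fun q : (𝔻 n : TopCat.{u}) => q.down.1 :=
      continuous_subtype_val.comp continuous_uliftDown
    exact Continuous.subtype_mk (by fun_prop) _

instance (n : ℕ) : T2Space (𝔻 n : TopCat.{u}) :=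
  inferInstanceAs (T2Space (ULift (Metric.closedBall (0 : EuclideanSpace ℝ (Fin n)) 1)))

instance (n : ℕ) : T2Space (∂𝔻 n : TopCat.{u}) :=
  inferInstanceAs (T2Space (ULift (Metric.sphere (0 : EuclideanSpace ℝ (Fin n)) 1)))

instance (n : ℕ) : IsCG (𝔻 n : TopCat.{u}) := isCG_of_compactHausdorff _

instance (n : ℕ) : IsCG (∂𝔻 n : TopCat.{u}) := isCG_of_compactHausdorff _

theorem diskStretch_zero {n : ℕ} (d : (𝔻 n : TopCat.{u})) : diskStretch n (d, 0) = d := by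
  refine ULift.down_injective (Subtype.ext ?_)
  change (min (max ‖d.down.1‖ (1 / 2))⁻¹ (1 + 4 * ((0 : I) : ℝ))) • d.down.1 = d.down.1
  have h1 := mem_closedBall_zero_iff.1 d.down.2
  rw [min_eq_right, Set.Icc.coe_zero, mul_zero, add_zero, one_smul]
  rw [Set.Icc.coe_zero, mul_zero, add_zero]
  exact (one_le_inv₀ (lt_max_of_lt_right (by norm_num))).2 (max_le h1 (by norm_num))

/-- At time `diskDepth` the factor `1 + 4 * depth` equals `3 - 2‖d‖`, which is already large enough
for the other term of the minimum to win. The stretch is thus complete by a time that vanishes on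
the boundary. In the outer range the inequality is `(2‖d‖ - 1)(1 - ‖d‖) ≥ 0`. -/
theorem diskStretch_depth {n : ℕ} (d : (𝔻 n : TopCat.{u})) :
    (diskStretch n (d, diskDepth n d)).down.1 = (max ‖d.down.1‖ (1 / 2))⁻¹ • d.down.1 := by
  change (min (max ‖d.down.1‖ (1 / 2))⁻¹ (1 + 4 * ((1 - ‖d.down.1‖) / 2))) • d.down.1 = _
  have h1 := mem_closedBall_zero_iff.1 d.down.2
  rw [min_eq_left]
  rw [inv_le_iff_one_le_mul₀ (lt_max_of_lt_right (by norm_num))]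
  rcases le_total ‖d.down.1‖ (1 / 2) with h | h
  · rw [max_eq_right h]
    linarith
  · rw [max_eq_left h]
    nlinarith

/-- The radial contraction of the disk. -/
noncomputable def diskContract (n : ℕ) : C(I × (𝔻 n : TopCat.{u}), (𝔻 n : TopCat.{u})) where
  toFun q := ⟨⟨(1 - q.1 : ℝ) • q.2.down.1, by
    have h1 := mem_closedBall_zero_iff.1 q.2.down.2
    have h2 := q.1.2.1
    have h3 := q.1.2.2
    rw [mem_closedBall_zero_iff, norm_smul, Real.norm_of_nonneg (by linarith)]
    exact mul_le_one₀ (by linarith) (norm_nonneg _) h1⟩⟩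
  continuous_toFun := by
    have hd : Continuous fun q : I × (𝔻 n : TopCat.{u}) => q.2.down.1 :=
      continuous_subtype_val.comp (continuous_uliftDown.comp continuous_snd)
    exact continuous_uliftUp.comp (Continuous.subtype_mk (Continuous.smul
      (continuous_const.sub (continuous_subtype_val.comp continuous_fst)) hd) _)

theorem homotopicRel_const_of_disk {n : ℕ} (f : C((𝔻 n : TopCat.{u}), C)) :
    ∃ c, f.HomotopicRel (ContinuousMap.const _ c) ∅ := by
  refine ⟨f ⟨⟨0, by simp⟩⟩, homotopicRel_iff.2 ⟨f.comp (diskContract n), fun d => ?_, fun d => ?_,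
    by simp⟩⟩
  · refine congrArg f (ULift.down_injective (Subtype.ext ?_))
    change (1 - ((0 : I) : ℝ)) • d.down.1 = d.down.1
    simp
  · refine congrArg f (ULift.down_injective (Subtype.ext ?_))
    change (1 - ((1 : I) : ℝ)) • d.down.1 = 0
    simp

/-- A map to `InvSpace` on the disk and a vertical homotopy on its boundary glue, over the
retraction of the disk that collapses an outer collar to the boundary. -/
theorem exists_disk_glue {n : ℕ} (f : C((𝔻 n : TopCat.{u}), C)) (V : C((𝔻 n : TopCat.{u}), h.InvSpace))
    (hV : ∀ d, h.invProj (V d) = f d) (J : C(I × (∂𝔻 n : TopCat.{u}), h.InvSpace))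
    (hJ0 : ∀ s, J (0, s) = V (diskBoundaryInclusion n s))
    (hJ : ∀ t s, h.invProj (J (t, s)) = f (diskBoundaryInclusion n s)) :
    ∃ W : C((𝔻 n : TopCat.{u}), h.InvSpace),
      (∀ d, h.invProj (W d) = f (diskStretch n (d, diskDepth n d))) ∧
      ∀ s, W (diskBoundaryInclusion n s) = J (1, s) := by
  classical
  have hd : Continuous fun q : (𝔻 n : TopCat.{u}) => q.down.1 :=
    continuous_subtype_val.comp continuous_uliftDown
  let κ : C((𝔻 n : TopCat.{u}), (𝔻 n : TopCat.{u})) :=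
    ⟨fun d => diskStretch n (d, diskDepth n d), by fun_prop⟩
  let ρ : ∀ d : (𝔻 n : TopCat.{u}), 1 / 2 ≤ ‖d.down.1‖ → (∂𝔻 n : TopCat.{u}) := fun d hd =>
    ⟨⟨‖d.down.1‖⁻¹ • d.down.1, by
      rw [mem_sphere_zero_iff_norm, norm_smul, norm_inv, norm_norm,
        inv_mul_cancel₀ (by linarith)]⟩⟩
  have hρ : ∀ d hd, diskBoundaryInclusion n (ρ d hd) = κ d := by
    intro d hd
    refine ULift.down_injective (Subtype.ext ?_)
    change ‖d.down.1‖⁻¹ • d.down.1 = (diskStretch n (d, diskDepth n d)).down.1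
    rw [diskStretch_depth, max_eq_left hd]
  -- `ρ` requires a proof that the point lies in the collar; `G` is a total function with the collar
  -- values, and its values elsewhere play no role.
  obtain ⟨G, hG⟩ : ∃ G : (𝔻 n : TopCat.{u}) → h.InvSpace, ∀ d (hd : 1 / 2 ≤ ‖d.down.1‖),
      G d = J (Set.projIcc 0 1 zero_le_one (2 * ‖d.down.1‖ - 1), ρ d hd) :=
    ⟨fun d => if hd : 1 / 2 ≤ ‖d.down.1‖ then
      J (Set.projIcc 0 1 zero_le_one (2 * ‖d.down.1‖ - 1), ρ d hd) else V (κ d),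
      fun d hd => dif_pos hd⟩
  refine ⟨⟨fun d => if ‖d.down.1‖ ≤ 1 / 2 then V (κ d) else G d, ?_⟩, fun d => ?_, fun s => ?_⟩
  · refine continuous_if_le hd.norm continuous_const (by fun_prop) ?_ ?_
    · rw [continuousOn_iff_continuous_domRestrict]
      refine Continuous.congr (f := fun d : {d : (𝔻 n : TopCat.{u}) | 1 / 2 ≤ ‖d.down.1‖} =>
        J (Set.projIcc 0 1 zero_le_one (2 * ‖d.1.down.1‖ - 1), ρ d.1 d.2)) ?_
        (fun d => (hG d.1 d.2).symm)
      have hd' : Continuous fun d : {d : (𝔻 n : TopCat.{u}) | 1 / 2 ≤ ‖d.down.1‖} => d.1.down.1 :=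
        hd.comp continuous_subtype_val
      refine J.continuous.comp (Continuous.prodMk ?_ ?_)
      · exact continuous_projIcc.comp ((continuous_const.mul hd'.norm).sub continuous_const)
      · refine continuous_uliftUp.comp (Continuous.subtype_mk (Continuous.smul
          (Continuous.inv₀ hd'.norm fun d => ?_) hd') _)
        exact ((by norm_num : (0 : ℝ) < 1 / 2).trans_le d.2).ne'
    · intro d hd
      have h0 : Set.projIcc (0 : ℝ) 1 zero_le_one (2 * ‖d.down.1‖ - 1) = 0 :=
        Set.projIcc_of_le_left _ (by linarith)
      rw [hG d hd.ge, h0, hJ0, hρ d hd.ge]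
  · change h.invProj (if ‖d.down.1‖ ≤ 1 / 2 then V (κ d) else G d) = f (κ d)
    split_ifs with hd
    · exact hV _
    · rw [hG d (le_of_not_ge hd), hJ, hρ d (le_of_not_ge hd)]
  · have hs : ‖(diskBoundaryInclusion.{u} n s).down.1‖ = 1 := mem_sphere_zero_iff_norm.1 s.down.2
    have h1 : Set.projIcc (0 : ℝ) 1 zero_le_one (2 * ‖(diskBoundaryInclusion.{u} n s).down.1‖ - 1)
        = 1 := Set.projIcc_of_right_le _ (by linarith)
    have hs' : 1 / 2 ≤ ‖(diskBoundaryInclusion.{u} n s).down.1‖ := by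
      rw [hs]
      norm_num
    have hρs : ρ (diskBoundaryInclusion n s) hs' = s := by
      refine ULift.down_injective (Subtype.ext ?_)
      change ‖(diskBoundaryInclusion.{u} n s).down.1‖⁻¹ • _ = _
      rw [hs, inv_one, one_smul]
      rfl
    refine (if_neg ?_).trans ((hG _ hs').trans ?_)
    · rw [hs]
      norm_num
    · rw [h1, hρs]

/-- Since `f` is null-homotopic, it represents a unit and has some lift `V`, with the wrong boundary
values. On the boundary `V` is vertically homotopic to `u`. Inserting that homotopy in a collar
gives the right boundary values over a radially stretched `f`, and transport back along the stretch,
stationary on the boundary, restores `f`. -/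
theorem exists_disk_lift [Fact h.IsHomotopyAssoc] (hg : h.IsGrouplike) {n : ℕ}
    (u : C((∂𝔻 n : TopCat.{u}), h.InvSpace)) (f : C((𝔻 n : TopCat.{u}), C))
    (huf : ∀ s, h.invProj (u s) = f (diskBoundaryInclusion n s)) :
    ∃ W : C((𝔻 n : TopCat.{u}), h.InvSpace), (∀ s, W (diskBoundaryInclusion n s) = u s) ∧
      ∀ d, h.invProj (W d) = f d := by
  obtain ⟨c, hc⟩ := homotopicRel_const_of_disk f
  obtain ⟨a, ha, -⟩ := isUnit_iff_exists.1 (isUnit_mk_of_homotopic_const hg f c hc)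
  obtain ⟨y, hy, rfl⟩ := HClass.exists_mk a
  obtain ⟨H, h0, h1, -⟩ := homotopicRel_iff.1 (HClass.mk_eq_mk.1 ha)
  let V : C((𝔻 n : TopCat.{u}), h.InvSpace) :=
    invMk f y (H.comp ContinuousMap.prodSwap) (fun x => h0 x) (fun x => h1 x)
  let i : C((∂𝔻 n : TopCat.{u}), (𝔻 n : TopCat.{u})) := (diskBoundaryInclusion n).hom
  obtain ⟨J, hJ0, hJ1, hJ⟩ := exists_invSpace_homotopy (V.comp i) u (f.comp i)
    (isUnit_mk_of_homotopic_const hg _ c (homotopicRel_precomp hc i (by simp)))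
    (fun s => rfl) huf
  obtain ⟨W, hW, hWs⟩ := exists_disk_glue f V (fun d => rfl) J hJ0 hJ
  obtain ⟨W', hW', hWl⟩ := exists_invSpace_transport W (f.comp (diskStretch n)) (diskDepth n)
    (fun d => by
      change (1 - ‖d.down.1‖) / 2 ≤ 1 / 2
      linarith [norm_nonneg d.down.1]) hW
  refine ⟨W', fun s => ?_, fun d => (hW' d).trans (congrArg f (diskStretch_zero d))⟩
  rw [hWl, hWs, hJ1]
  have hs : ‖(diskBoundaryInclusion.{u} n s).down.1‖ = 1 := mem_sphere_zero_iff_norm.1 s.down.2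
  refine Subtype.ext ?_
  change (1 - ‖(diskBoundaryInclusion.{u} n s).down.1‖) / 2 = 0
  rw [hs]
  norm_num

end Disk

/-- The projection has the right lifting property against disk boundary inclusions, and a CW complex
is a transfinite composition of pushouts of coproducts of these, starting from the empty space. -/
theorem exists_cw_lift [Fact h.IsHomotopyAssoc] (hg : h.IsGrouplike) {X : TopCat.{u}}
    (hX : Nonempty (TopCat.CWComplex X)) (f : C(X, C)) :
    ∃ W : C(X, h.InvSpace), ∀ x, h.invProj (W x) = f x := by
  obtain ⟨c⟩ := hX
  let p : TopCat.of h.InvSpace ⟶ TopCat.of C := TopCat.ofHom h.invProj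
  let J : MorphismProperty TopCat.{u} :=
    MorphismProperty.ofHoms fun n : ℕ => TopCat.diskBoundaryInclusion.{u} n
  have hp : J.rlp p := by
    rintro _ _ _ ⟨n⟩
    refine ⟨fun {u f} sq => ?_⟩
    obtain ⟨W, h1, h2⟩ := exists_disk_lift hg u.hom f.hom
      (fun s => ConcreteCategory.congr_hom sq.w s)
    exact ⟨⟨⟨TopCat.ofHom W, TopCat.hom_ext (ContinuousMap.ext h1),
      TopCat.hom_ext (ContinuousMap.ext h2)⟩⟩⟩
  have hi : J.rlp.llp (Limits.initial.to X) :=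
    J.transfiniteCompositionsOfShape_pushouts_coproducts_le_llp_rlp ℕ _
      ⟨c.transfiniteCompositionOfShape' fun s => ⟨s.j⟩⟩
  have := hi _ hp
  have sq : CommSq (Limits.initial.to _) (Limits.initial.to X) p (TopCat.ofHom f) :=
    ⟨Limits.initial.hom_ext _ _⟩
  exact ⟨sq.lift.hom, fun x => ConcreteCategory.congr_hom sq.fac_right x⟩

/-- A grouplike homotopy associative H-space of the homotopy type of a CW complex has a right
inverse up to free homotopy. -/
theorem exists_free_right_inverse [Fact h.IsHomotopyAssoc] (hg : h.IsGrouplike)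
    (hcw : HasCWHomotopyType C) : ∃ ι : C(C, C),
      (h.pmul (ContinuousMap.id C) ι).HomotopicRel (ContinuousMap.const C h.e) ∅ := by
  obtain ⟨X, hX, ⟨E⟩⟩ := hcw
  obtain ⟨W, hW⟩ := exists_cw_lift (h := h) hg hX E.invFun
  have hE : (ContinuousMap.id C).HomotopicRel (E.invFun.comp E.toFun) ∅ :=
    (homotopicRel_empty.2 E.left_inv).symm
  refine ⟨(h.invSnd.comp W).comp E.toFun, (h.pmul_homotopicRel hE (.refl _)).trans ?_⟩
  refine homotopicRel_iff.2 ⟨h.invEval.comp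
    (((W.comp E.toFun).comp ContinuousMap.snd).prodMk ContinuousMap.fst), fun x => ?_, fun x => ?_,
      by simp⟩
  · refine (invEval_zero _).trans ?_
    change h.mul (kpt (h.invProj (W (E.toFun x))) _) = _
    rw [hW]
    rfl
  · exact invEval_one _

end KHSpace

end CWComplexes

/-! ### Non-degenerate base points and homotopy extension. -/

/-- A contraction onto `y` of a neighborhood `{v ≤ 1/2}` of `y`, through maps of the whole space
that fix `y`. -/
structure NbhdContraction {Y : Type*} [TopologicalSpace Y] (y : Y) where
  v : C(Y, I)
  F : C(I × Y, Y)
  v_pt : v y = 0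
  F_zero : ∀ x, F (0, x) = x
  F_pt : ∀ t, F (t, y) = y
  F_one : ∀ x, (v x : ℝ) ≤ 1 / 2 → F (1, x) = y

theorem IsNondegenerate.exists_nbhdContraction {Y : Type u} [TopologicalSpace Y] {y : Y}
    (hy : IsNondegenerate y) : Nonempty (NbhdContraction y) := by
  obtain ⟨v, F, hv, h0, hF, h1⟩ := hy
  exact ⟨⟨v, F, (hv y).2 rfl, h0, hF, fun x hx => h1 x (Subtype.coe_lt_coe.1
    (hx.trans_lt (by norm_num)))⟩⟩

namespace NbhdContraction

variable {Y : Type*} [TopologicalSpace Y] {y : Y} (c : NbhdContraction y)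

/-- The final map of the contraction. -/
def last : C(Y, Y) := c.F.comp ((ContinuousMap.const Y 1).prodMk (ContinuousMap.id Y))

theorem last_pt : c.last y = y := c.F_pt 1

theorem last_eq {x : Y} (hx : (c.v x : ℝ) ≤ 1 / 2) : c.last x = y := c.F_one x hx

theorem id_homotopicRel_last : (ContinuousMap.id Y).HomotopicRel c.last {y} :=
  homotopicRel_iff.2 ⟨c.F, c.F_zero, fun _ => rfl, fun t x hx => by
    rw [Set.mem_singleton_iff.1 hx]
    exact c.F_pt t⟩

end NbhdContraction

/-- The clamped parameter `1 - 2 v`, scaled by `s`. -/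
noncomputable def ramp : C(I × I, I) :=
  ⟨fun q => q.1 * Set.projIcc 0 1 zero_le_one (1 - 2 * (q.2 : ℝ)),
    continuous_fst.mul (continuous_projIcc.comp (by fun_prop))⟩

theorem ramp_zero_left (v : I) : ramp (0, v) = 0 := zero_mul _

theorem ramp_one_zero : ramp (1, 0) = 1 := by
  refine (one_mul _).trans (Set.projIcc_of_right_le _ ?_)
  simp

theorem ramp_half (s : I) {v : I} (hv : (v : ℝ) = 1 / 2) : ramp (s, v) = 0 := by
  refine (congrArg (s * ·) (Set.projIcc_of_le_left _ ?_)).trans (mul_zero _)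
  rw [hv]
  norm_num

section Pushing

variable {Z Y : Type*} [TopologicalSpace Z] [TopologicalSpace Y]

/-- If `R` is the final map of a contraction of a neighborhood `{v ≤ 1/2}`, then a homotopy `G` of
`N ∘ R` on this neighborhood extends to all of `Z`. -/
theorem exists_homotopy_extension (N : C(Z, Y)) (R : C(Z, Z)) (v : C(Z, I)) (G : C(I × Z, Y))
    (hG : ∀ z, (v z : ℝ) ≤ 1 / 2 → G (0, z) = N (R z)) :
    ∃ H : C(I × Z, Y), (∀ z, H (0, z) = N (R z)) ∧ (∀ z, v z = 0 → H (1, z) = G (1, z)) ∧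
      ∀ z, ((v z : ℝ) ≤ 1 / 2 → ∀ s, G (s, z) = N (R z)) → ∀ s, H (s, z) = N (R z) := by
  -- The ramp runs `G` at full speed where `v = 0` and stops it at `v = 1/2`, where it meets `N ∘
  -- R`.
  refine ⟨⟨fun q => if (v q.2 : ℝ) ≤ 1 / 2 then G (ramp (q.1, v q.2), q.2) else N (R q.2), ?_⟩,
    fun z => ?_, fun z hz => ?_, fun z hz s => ?_⟩
  · refine Continuous.if_le (by fun_prop) (by fun_prop) (by fun_prop) (by fun_prop) ?_
    intro q hq
    rw [ramp_half _ hq, hG _ hq.le]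
  · change (if (v z : ℝ) ≤ 1 / 2 then G (ramp (0, v z), z) else N (R z)) = _
    split_ifs with h
    · rw [ramp_zero_left, hG z h]
    · rfl
  · change (if (v z : ℝ) ≤ 1 / 2 then G (ramp (1, v z), z) else N (R z)) = _
    rw [if_pos (by rw [hz]; norm_num), hz, ramp_one_zero]
  · change (if (v z : ℝ) ≤ 1 / 2 then G (ramp (s, v z), z) else N (R z)) = _
    split_ifs with h
    · exact hz h _
    · rfl

/-- A based map that is freely null-homotopic is null-homotopic relative to the base point. -/
theorem homotopicRel_const_of_free {z₀ : Z} (c : NbhdContraction z₀) {f : C(Z, Y)} {y₀ : Y}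
    (hf : f z₀ = y₀) (hf' : f.HomotopicRel (ContinuousMap.const Z y₀) ∅) :
    f.HomotopicRel (ContinuousMap.const Z y₀) {z₀} := by
  obtain ⟨H, h0, h1, -⟩ := homotopicRel_iff.1 hf'
  let p : C(ℝ, I) := ⟨Set.projIcc 0 1 zero_le_one, continuous_projIcc⟩
  have hp1 : ∀ x : ℝ, 1 ≤ x → p x = 1 := fun x hx => Set.projIcc_of_right_le zero_le_one hx
  have hp0 : ∀ x : ℝ, x ≤ 0 → p x = 0 := fun x hx => Set.projIcc_of_le_left zero_le_one hx
  -- After `H` has reached the constant map, its base-point track is run backwards for all points at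
  -- once. The result is still a null-homotopy of `f`, and its base-point track is a loop followed
  -- by its reverse.
  let N : C(I × Z, Y) :=
    { toFun := fun q => if (q.1 : ℝ) ≤ 1 / 2 then H (p (2 * q.1), q.2) else H (p (2 - 2 * q.1), z₀)
      continuous_toFun := by
        refine Continuous.if_le (by fun_prop) (by fun_prop) (by fun_prop) (by fun_prop) ?_
        intro q hq
        rw [hp1 _ (by linarith), hp1 _ (by linarith), h1, h1]
        rfl }
  have hN0 : ∀ z, N (0, z) = f z := fun z => by
    change (if ((0 : I) : ℝ) ≤ 1 / 2 then H (p (2 * (0 : I)), z) else _) = _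
    rw [if_pos (by norm_num), hp0 _ (by simp), h0]
  have hN1 : ∀ z, N (1, z) = y₀ := fun z => by
    change (if ((1 : I) : ℝ) ≤ 1 / 2 then _ else H (p (2 - 2 * (1 : I)), z₀)) = _
    rw [if_neg (by norm_num), hp0 _ (by simp), h0, hf]
  -- Contraction of that track, by scaling its parameter to zero; it is stationary at both ends `t =
  -- 0, 1`.
  let G : C(I × (I × Z), Y) :=
    ⟨fun q => H (p ((1 - q.1) * min (2 * (q.2.1 : ℝ)) (2 - 2 * q.2.1)), z₀), by fun_prop⟩
  have hG : ∀ q : I × Z, (c.v q.2 : ℝ) ≤ 1 / 2 → G (0, q) = N (q.1, c.last q.2) := by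
    intro q hq
    change H (p ((1 - (0 : I)) * min (2 * (q.1 : ℝ)) (2 - 2 * q.1)), z₀) = if (q.1 : ℝ) ≤ 1 / 2 then
      H (p (2 * q.1), c.last q.2) else H (p (2 - 2 * q.1), z₀)
    rw [Set.Icc.coe_zero, sub_zero, one_mul, c.last_eq hq]
    split_ifs with h
    · rw [min_eq_left (by linarith)]
    · rw [min_eq_right (by linarith)]
  have hGend : ∀ (t : I) (z : Z) (s : I), (t = 0 ∨ t = 1) → G (s, (t, z)) = y₀ := by
    intro t z s ht
    change H (p ((1 - s) * min (2 * (t : ℝ)) (2 - 2 * t)), z₀) = _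
    rw [hp0, h0, hf]
    rcases ht with rfl | rfl <;> simp
  obtain ⟨K, -, hK1, hK⟩ := exists_homotopy_extension N
    ((ContinuousMap.id I).prodMap c.last) (c.v.comp ContinuousMap.snd) G hG
  have step : (f.comp c.last).HomotopicRel (ContinuousMap.const Z y₀) {z₀} := by
    refine homotopicRel_iff.2 ⟨K.comp ((ContinuousMap.const _ 1).prodMk (ContinuousMap.id _)),
      fun z => ?_, fun z => ?_, fun t z hz => ?_⟩
    · refine (hK (0, z) (fun h s => ?_) 1).trans (hN0 _)
      rw [hGend _ _ _ (Or.inl rfl)]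
      refine Eq.trans ?_ (hN0 _).symm
      exact hf.symm.trans (congrArg f (c.last_eq h).symm)
    · refine (hK (1, z) (fun h s => ?_) 1).trans (hN1 _)
      rw [hGend _ _ _ (Or.inr rfl)]
      exact (hN1 _).symm
    · rw [Set.mem_singleton_iff.1 hz]
      refine (hK1 (t, z₀) c.v_pt).trans ?_
      change H (p ((1 - (1 : I)) * min (2 * (t : ℝ)) (2 - 2 * t)), z₀) = f (c.last z₀)
      rw [Set.Icc.coe_one, sub_self, zero_mul, hp0 _ le_rfl, h0, c.last_pt]
  exact (homotopicRel_postcomp c.id_homotopicRel_last f).trans step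

end Pushing

/-! ### The based right inverse. -/

namespace KHSpace

variable {C : Type u} [TopologicalSpace C] [IsCG C] {h : KHSpace C}

/-- A based right inverse up to based homotopy. -/
def IsRightInverse (h : KHSpace C) (ι : C(C, C)) : Prop :=
  ι h.e = h.e ∧
    (h.pmul (ContinuousMap.id C) ι).HomotopicRel (ContinuousMap.const C h.e) {h.e}

/-- For a free right inverse `j`, the unit homotopy joins `j e` to `e * j e` and the inverse
homotopy joins that to `e`. Extending this path over `C` makes `j` based. The null-homotopy of the
product then becomes based by `homotopicRel_const_of_free`. -/
theorem exists_isRightInverse [Fact h.IsHomotopyAssoc] (hg : h.IsGrouplike)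
    (hcw : HasCWHomotopyType C) (c : NbhdContraction h.e) : ∃ ι, h.IsRightInverse ι := by
  obtain ⟨j, hj⟩ := exists_free_right_inverse (h := h) hg hcw
  obtain ⟨H, h0, h1, -⟩ := homotopicRel_iff.1 hj
  obtain ⟨U, hU0, hU1, -⟩ := homotopicRel_iff.1 h.one_mul
  have hpath : Joined (j h.e) h.e :=
    Joined.trans (Joined.symm ⟨⟨⟨fun t => U (t, j h.e), by fun_prop⟩, hU0 _, hU1 _⟩⟩)
      ⟨⟨⟨fun t => H (t, h.e), by fun_prop⟩, h0 _, h1 _⟩⟩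
  obtain ⟨p⟩ := hpath
  obtain ⟨K, hK0, hK1, -⟩ := exists_homotopy_extension j c.last c.v
    (p.toContinuousMap.comp ContinuousMap.fst)
    (fun z hz => p.source.trans (congrArg j (c.last_eq hz).symm))
  let ι : C(C, C) := K.comp ((ContinuousMap.const _ 1).prodMk (ContinuousMap.id _))
  have hι : ι h.e = h.e := (hK1 _ c.v_pt).trans p.target
  have hjι : j.HomotopicRel ι ∅ :=
    (homotopicRel_mono (homotopicRel_postcomp c.id_homotopicRel_last j) (by simp)).trans
      (homotopicRel_iff.2 ⟨K, hK0, fun _ => rfl, by simp⟩)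
  refine ⟨ι, hι, homotopicRel_const_of_free c ?_
    ((h.pmul_homotopicRel (.refl _) hjι.symm).trans hj)⟩
  exact (congrArg h.mul (congrArg (kpt h.e) hι)).trans h.mul_e_e

variable {T : Type u} [TopologicalSpace T] [IsCG T]

/-- Composition with `ι` gives every class a right inverse, so the monoid of classes is a group,
with no condition on the source. -/
theorem IsRightInverse.isUnit [Fact h.IsHomotopyAssoc] {ι : C(C, C)} (hι : h.IsRightInverse ι)
    {S : Set T} (a : h.HClass S) : IsUnit a := by
  refine isUnit_of_forall_exists_mul_eq_one (fun a => ?_) a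
  obtain ⟨f, hf, rfl⟩ := HClass.exists_mk a
  refine ⟨HClass.mk (ι.comp f) fun x hx => (congrArg ι (hf x hx)).trans hι.1, ?_⟩
  exact HClass.mk_eq_mk.2 (homotopicRel_precomp hι.2 f hf)

end KHSpace

/-! ### Maps and homotopies on smash products. -/

section SmashLift

variable {X Y Z : Type u} [TopologicalSpace X] [TopologicalSpace Y] [TopologicalSpace Z]
  {x₀ : X} {y₀ : Y}

/-- The map on the smash product induced by a map that is constant on the wedge. -/
def smashLift (f : C(KProd X Y, Z)) (z : Z) (hf : ∀ p, kFst p = x₀ ∨ kSnd p = y₀ → f p = z) :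
    C(Smash x₀ y₀, Z) :=
  ⟨Quot.lift f fun p q hpq => (hf p hpq.1).trans (hf q hpq.2).symm,
    continuous_quot_lift _ f.continuous⟩

theorem smashMk_eq_smashPt {p : KProd X Y} (hp : kFst p = x₀ ∨ kSnd p = y₀) :
    smashMk x₀ y₀ p = smashPt x₀ y₀ :=
  Quot.sound ⟨hp, Or.inl rfl⟩

/-- A homotopy that is constant on the wedge induces a homotopy on the smash product. -/
theorem exists_smash_homotopy (f : C(I × KProd X Y, Z)) (z : Z)
    (hf : ∀ t p, kFst p = x₀ ∨ kSnd p = y₀ → f (t, p) = z) :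
    ∃ H : C(I × Smash x₀ y₀, Z), ∀ t p, H (t, smashMk x₀ y₀ p) = f (t, p) := by
  -- With time curried away, continuity on the smash product follows from the quotient topology
  -- alone.
  let g : C(KProd X Y, C(I, Z)) := (f.comp ContinuousMap.prodSwap).curry
  let G : Smash x₀ y₀ → C(I, Z) := Quot.lift g fun p q hpq =>
    ContinuousMap.ext fun t => (hf t p hpq.1).trans (hf t q hpq.2).symm
  have hG : Continuous G := continuous_quot_lift _ g.continuous
  exact ⟨⟨fun q => G q.2 q.1, by fun_prop⟩, fun t p => rfl⟩

theorem id_homotopicRel_smashMap_last (c : NbhdContraction x₀) (d : NbhdContraction y₀) :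
    (ContinuousMap.id (Smash x₀ y₀)).HomotopicRel
      (smashMap c.last d.last c.last_pt d.last_pt) {smashPt x₀ y₀} := by
  let K : C(I × KProd X Y, KProd X Y) := kPair
    (c.F.comp ((ContinuousMap.id I).prodMap kFst)) (d.F.comp ((ContinuousMap.id I).prodMap kSnd))
  have hK : ∀ t p, kFst p = x₀ ∨ kSnd p = y₀ → smashMk x₀ y₀ (K (t, p)) = smashPt x₀ y₀ := by
    rintro t p (hp | hp)
    · exact smashMk_eq_smashPt (Or.inl ((congrArg (fun x => c.F (t, x)) hp).trans (c.F_pt t)))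
    · exact smashMk_eq_smashPt (Or.inr ((congrArg (fun x => d.F (t, x)) hp).trans (d.F_pt t)))
  obtain ⟨H, hH⟩ := exists_smash_homotopy ((smashMk x₀ y₀).comp K) _ hK
  refine homotopicRel_iff.2 ⟨H, ?_, ?_, ?_⟩
  · rintro ⟨p⟩
    exact (hH 0 p).trans (congrArg (smashMk x₀ y₀)
      (congrArg₂ kpt (c.F_zero (kFst p)) (d.F_zero (kSnd p))))
  · rintro ⟨p⟩
    exact hH 1 p
  · rintro t _ rfl
    exact (hH t _).trans (hK t _ (Or.inl rfl))

end SmashLift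

namespace KHSpace

variable {C : Type u} [TopologicalSpace C] [IsCG C] {h : KHSpace C} {ι : C(C, C)}

/-- Multiplication by an inverse turns a map into one that is trivial on `{v = 0}`. -/
theorem IsRightInverse.exists_reduced (hι : h.IsRightInverse ι) {Z : Type u} [TopologicalSpace Z]
    [IsCG Z] (N : C(Z, C)) (p R : C(Z, Z)) (v : C(Z, I)) (hpR : ∀ z, p (R z) = p z)
    (hR : ∀ z, (v z : ℝ) ≤ 1 / 2 → R z = p z) :
    ∃ N' : C(Z, C), (∀ z, v z = 0 → N' z = h.e) ∧
      ∀ z, N (p z) = h.e → N' z = h.mul (kpt (N (R z)) h.e) := by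
  obtain ⟨K, hK0, hK1, hK⟩ := homotopicRel_iff.1 hι.2
  have hKe : ∀ t, K (t, h.e) = h.e := fun t => (hK t h.e rfl).trans
    ((congrArg h.mul (congrArg (kpt h.e) hι.1)).trans h.mul_e_e)
  -- Near `{v = 0}`, where `R` agrees with `p`, the map `M ∘ R` has the form `a * ι a` with `a = N
  -- (p z)`, and `K` contracts it to the unit.
  let M : C(Z, C) := h.pmul N (ι.comp (N.comp p))
  have hM : ∀ z, M (R z) = h.mul (kpt (N (R z)) (ι (N (p z)))) := fun z => by
    change h.mul (kpt (N (R z)) (ι (N (p (R z))))) = _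
    rw [hpR]
  obtain ⟨H, -, hH1, hH⟩ := exists_homotopy_extension M R v
    (K.comp ((ContinuousMap.id I).prodMap (N.comp p))) (fun z hz => by
      rw [hM, hR z hz]
      exact hK0 _)
  refine ⟨H.comp ((ContinuousMap.const _ 1).prodMk (ContinuousMap.id _)), fun z hz => ?_,
    fun z hz => ?_⟩
  · exact (hH1 z hz).trans (hK1 _)
  · have hMz : M (R z) = h.mul (kpt (N (R z)) h.e) := by rw [hM, hz, hι.1]
    refine (hH z (fun hv s => ?_) 1).trans hMz
    rw [hMz, hR z hv, hz, h.mul_e_e]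
    exact (congrArg (fun c => K (s, c)) hz).trans (hKe s)

variable {X Y : Type u} [TopologicalSpace X] [TopologicalSpace Y] [IsCG X] [IsCG Y]
  {x₀ : X} {y₀ : Y}

/-- A based map from a smash product to a grouplike H-space is null-homotopic if its composite
with the quotient map is. -/
theorem IsRightInverse.homotopicRel_const_of_smashMk [Fact h.IsHomotopyAssoc]
    (hι : h.IsRightInverse ι) (c : NbhdContraction x₀) (d : NbhdContraction y₀)
    (g : C(Smash x₀ y₀, C)) (hg : g (smashPt x₀ y₀) = h.e)
    (hnull : (g.comp (smashMk x₀ y₀)).HomotopicRel (ContinuousMap.const _ h.e) {kpt x₀ y₀}) :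
    g.HomotopicRel (ContinuousMap.const _ h.e) {smashPt x₀ y₀} := by
  obtain ⟨N, hN0, hN1, hN⟩ := homotopicRel_iff.1 hnull
  have hgw : ∀ p, kFst p = x₀ ∨ kSnd p = y₀ → g (smashMk x₀ y₀ p) = h.e := fun p hp =>
    (congrArg g (smashMk_eq_smashPt hp)).trans hg
  -- The null-homotopy need not be trivial on the wedge. It is divided by its restriction to the
  -- axis `y = y₀`, then by its restriction to `x = x₀`; the second division preserves triviality on
  -- the first axis.
  obtain ⟨N₁, hN₁e, hN₁⟩ := hι.exists_reduced N
    ((ContinuousMap.id I).prodMap (kMap (ContinuousMap.id X) (ContinuousMap.const Y y₀)))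
    ((ContinuousMap.id I).prodMap (kMap (ContinuousMap.id X) d.last))
    (d.v.comp (kSnd.comp ContinuousMap.snd)) (fun z => rfl)
    (fun z hz => congrArg (fun y => (z.1, kpt (kFst z.2) y)) (d.last_eq hz))
  obtain ⟨N₂, hN₂e, hN₂⟩ := hι.exists_reduced N₁
    ((ContinuousMap.id I).prodMap (kMap (ContinuousMap.const X x₀) (ContinuousMap.id Y)))
    ((ContinuousMap.id I).prodMap (kMap c.last (ContinuousMap.id Y)))
    (c.v.comp (kFst.comp ContinuousMap.snd)) (fun z => rfl)
    (fun z hz => congrArg (fun x => (z.1, kpt x (kSnd z.2))) (c.last_eq hz))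
  have hN' : ∀ (t : I) (x : X) (y : Y), N (t, kpt x y₀) = h.e →
      N₁ (t, kpt x y) = h.mul (kpt (N (t, kpt x (d.last y))) h.e) := fun t x y => hN₁ (t, kpt x y)
  have hN₁' : ∀ (t : I) (x : X) (y : Y), N₁ (t, kpt x₀ y) = h.e →
      N₂ (t, kpt x y) = h.mul (kpt (N₁ (t, kpt (c.last x) y)) h.e) :=
    fun t x y => hN₂ (t, kpt x y)
  have hN₁y : ∀ t x, N₁ (t, kpt x y₀) = h.e := fun t x => hN₁e (t, kpt x y₀) d.v_pt
  have hN₂x : ∀ t y, N₂ (t, kpt x₀ y) = h.e := fun t y => hN₂e (t, kpt x₀ y) c.v_pt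
  have hN₂y : ∀ t x, N₂ (t, kpt x y₀) = h.e := fun t x => by
    rw [hN₁' t x y₀ (hN₁y t x₀), hN₁y, h.mul_e_e]
  have hwedge : ∀ t p, kFst p = x₀ ∨ kSnd p = y₀ → N₂ (t, p) = h.e := by
    rintro t p (hp | hp)
    · exact (congrArg (fun x => N₂ (t, kpt x (kSnd p))) hp).trans (hN₂x t _)
    · exact (congrArg (fun y => N₂ (t, kpt (kFst p) y)) hp).trans (hN₂y t _)
  obtain ⟨H, hH⟩ := exists_smash_homotopy N₂ h.e hwedge
  let g' : C(Smash x₀ y₀, C) := g.comp (smashMap c.last d.last c.last_pt d.last_pt)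
  have hgg' : g.HomotopicRel g' {smashPt x₀ y₀} :=
    homotopicRel_postcomp (id_homotopicRel_smashMap_last c d) g
  have hg' : ∀ p ∈ ({smashPt x₀ y₀} : Set (Smash x₀ y₀)), g' p = h.e := by
    rintro _ rfl
    exact (congrArg g (smashMk_eq_smashPt (Or.inl c.last_pt))).trans hg
  -- At time 0 each division only multiplies by the unit, since `g ∘ smashMk` is trivial on the
  -- axes; hence the two factors `1`.
  have key : (HClass.mk g' hg' * 1 * 1 : h.HClass {smashPt x₀ y₀}) = 1 := by
    refine HClass.mk_eq_mk.2 (homotopicRel_iff.2 ⟨H, ?_, ?_, ?_⟩)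
    · rintro ⟨p⟩
      refine (hH 0 p).trans ?_
      refine (hN₁' 0 (kFst p) (kSnd p) ?_).trans ?_
      · rw [hN' 0 _ _ ((hN0 _).trans (hgw _ (Or.inr rfl))), hN0]
        rw [ContinuousMap.comp_apply, hgw _ (Or.inl rfl), h.mul_e_e]
      · rw [hN' 0 _ _ ((hN0 _).trans (hgw _ (Or.inr rfl))), hN0]
        rfl
    · rintro ⟨p⟩
      refine (hH 1 p).trans ?_
      have h1 : ∀ x y, N₁ (1, kpt x y) = h.e := fun x y => by
        rw [hN' 1 _ _ (hN1 _), hN1]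
        exact h.mul_e_e
      refine (hN₁' 1 (kFst p) (kSnd p) (h1 _ _)).trans ?_
      rw [h1]
      exact h.mul_e_e
    · rintro t _ rfl
      refine (hH t _).trans ((hwedge t _ (Or.inl rfl)).trans ?_)
      change h.e = h.mul (kpt (h.mul (kpt (g' (smashPt x₀ y₀)) h.e)) h.e)
      rw [hg' _ rfl, h.mul_e_e, h.mul_e_e]
  rw [_root_.mul_one, _root_.mul_one] at key
  exact hgg'.trans (HClass.mk_eq_mk.1 key)

end KHSpace

/-! ### Existence of deviations. -/

namespace KHSpace

/-- A based map into a grouplike H-space has a deviation from being an H-map. -/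
theorem exists_isDeviation {X Y : Type u} [TopologicalSpace X] [TopologicalSpace Y] [IsCG X]
    [IsCG Y] {hX : KHSpace X} {hY : KHSpace Y} [Fact hY.IsHomotopyAssoc] {ι : C(Y, Y)}
    (hι : hY.IsRightInverse ι) (c : NbhdContraction hX.e) (f : C(X, Y)) (hf : f hX.e = hY.e) :
    ∃ D, hX.IsDeviation hY f D := by
  let x₀ := hX.e
  let S : Set (KProd X X) := {kpt x₀ x₀}
  let P : C(KProd X X, Y) := f.comp hX.mul
  have hP : ∀ p ∈ S, P p = hY.e := by
    rintro _ rfl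
    exact (congrArg f hX.mul_e_e).trans hf
  have hf₁ : ∀ p ∈ S, f.comp kFst p = hY.e := by
    rintro _ rfl
    exact hf
  have hf₂ : ∀ p ∈ S, f.comp kSnd p = hY.e := by
    rintro _ rfl
    exact hf
  have hf' : ∀ x ∈ ({x₀} : Set X), f x = hY.e := by
    rintro _ rfl
    exact hf
  let Q : hY.HClass S := HClass.mk _ hf₁ * HClass.mk _ hf₂
  -- The class of `(f x * f y) * (f (x * y))⁻¹`.
  obtain ⟨d, hd⟩ : ∃ d : hY.HClass S, d * HClass.mk P hP = Q := by
    obtain ⟨b, -, hb⟩ := isUnit_iff_exists.1 (hι.isUnit (HClass.mk P hP))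
    exact ⟨Q * b, by rw [mul_assoc, hb, _root_.mul_one]⟩
  let i₁ : C(X, KProd X X) := kPair (ContinuousMap.id X) (ContinuousMap.const X x₀)
  let i₂ : C(X, KProd X X) := kPair (ContinuousMap.const X x₀) (ContinuousMap.id X)
  have hi₁ : Set.MapsTo i₁ {x₀} S := by
    rintro _ rfl
    rfl
  have hi₂ : Set.MapsTo i₂ {x₀} S := by
    rintro _ rfl
    rfl
  have hfc : ∀ hc, (HClass.mk (ContinuousMap.const X (f x₀)) hc : hY.HClass {x₀}) = 1 := by
    rw [hf]
    exact fun _ => rfl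
  -- On an axis both `f (x * y)` and `f x * f y` reduce to `f`, so the relation for `d` cancels to
  -- triviality.
  have hdi₁ : HClass.comap i₁ hi₁ d = 1 := by
    have h1 := congrArg (HClass.comap i₁ hi₁) hd
    have h2 : (HClass.comap i₁ hi₁ (HClass.mk P hP) : hY.HClass {x₀}) = HClass.mk f hf' :=
      HClass.mk_eq_mk.2 (homotopicRel_postcomp hX.mul_one f)
    have h3 : HClass.comap i₁ hi₁ Q = HClass.mk f hf' * 1 :=
      congrArg (HClass.mk f hf' * ·) (hfc fun _ _ => hf)
    rw [HClass.comap_mul, h2, h3, _root_.mul_one] at h1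
    exact (hι.isUnit (HClass.mk f hf')).mul_eq_right.1 h1
  have hdi₂ : HClass.comap i₂ hi₂ d = 1 := by
    have h1 := congrArg (HClass.comap i₂ hi₂) hd
    have h2 : (HClass.comap i₂ hi₂ (HClass.mk P hP) : hY.HClass {x₀}) = HClass.mk f hf' :=
      HClass.mk_eq_mk.2 (homotopicRel_postcomp hX.one_mul f)
    have h3 : HClass.comap i₂ hi₂ Q = 1 * HClass.mk f hf' :=
      congrArg (· * HClass.mk f hf') (hfc fun _ _ => hf)
    rw [HClass.comap_mul, h2, h3, _root_.one_mul] at h1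
    exact (hι.isUnit (HClass.mk f hf')).mul_eq_right.1 h1
  obtain ⟨N, hN, rfl⟩ := HClass.exists_mk d
  have hN0 : N (kpt x₀ x₀) = hY.e := hN _ rfl
  obtain ⟨G, hG0, hG1, hG⟩ := homotopicRel_iff.1 (HClass.mk_eq_mk.1 hdi₁)
  let R : C(KProd X X, KProd X X) := kMap (ContinuousMap.id X) c.last
  have hRS : (ContinuousMap.id (KProd X X)).HomotopicRel R S := by
    refine homotopicRel_iff.2 ⟨kPair (kFst.comp ContinuousMap.snd)
      (c.F.comp ((ContinuousMap.id I).prodMap kSnd)), fun p => ?_, fun p => rfl, ?_⟩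
    · exact congrArg (kpt (kFst p)) (c.F_zero _)
    · rintro t _ rfl
      exact congrArg (kpt x₀) (c.F_pt t)
  obtain ⟨H, hH0, hH1, hH⟩ := exists_homotopy_extension N R (c.v.comp kSnd)
    (G.comp ((ContinuousMap.id I).prodMap kFst)) (fun p hp => (hG0 (kFst p)).trans
      (congrArg (fun y => N (kpt (kFst p) y)) (c.last_eq hp).symm))
  let N₁ : C(KProd X X, Y) := H.comp ((ContinuousMap.const _ 1).prodMk (ContinuousMap.id _))
  have hNN₁ : N.HomotopicRel N₁ S := by
    refine (homotopicRel_postcomp hRS N).trans (homotopicRel_iff.2 ⟨H, hH0, fun _ => rfl, ?_⟩)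
    rintro t _ rfl
    refine hH _ (fun _ s => ?_) t
    refine (hG s x₀ rfl).trans ?_
    exact congrArg (fun y => N (kpt x₀ y)) c.last_pt.symm
  have hN₁y : ∀ x, N₁ (kpt x x₀) = hY.e := fun x => (hH1 _ c.v_pt).trans (hG1 _)
  have hN₁ : ∀ p ∈ S, N₁ p = hY.e := by
    rintro _ rfl
    exact hN₁y _
  have hdi₂' : HClass.comap i₂ hi₂ (HClass.mk N₁ hN₁) = (1 : hY.HClass {x₀}) := by
    rw [← hdi₂]
    exact congrArg _ (HClass.mk_eq_mk.2 hNN₁.symm)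
  obtain ⟨G', hG'0, hG'1, hG'⟩ := homotopicRel_iff.1 (HClass.mk_eq_mk.1 hdi₂')
  have hG'e : ∀ s, G' (s, x₀) = hY.e := fun s => (hG' s x₀ rfl).trans (hN₁y x₀)
  let R' : C(KProd X X, KProd X X) := kMap c.last (ContinuousMap.id X)
  have hRS' : (ContinuousMap.id (KProd X X)).HomotopicRel R' S := by
    refine homotopicRel_iff.2 ⟨kPair (c.F.comp ((ContinuousMap.id I).prodMap kFst))
      (kSnd.comp ContinuousMap.snd), fun p => ?_, fun p => rfl, ?_⟩
    · exact congrArg (fun x => kpt x (kSnd p)) (c.F_zero _)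
    · rintro t _ rfl
      exact congrArg (fun x => kpt x x₀) (c.F_pt t)
  obtain ⟨H', hH'0, hH'1, hH'⟩ := exists_homotopy_extension N₁ R' (c.v.comp kFst)
    (G'.comp ((ContinuousMap.id I).prodMap kSnd)) (fun p hp => (hG'0 (kSnd p)).trans
      (congrArg (fun x => N₁ (kpt x (kSnd p))) (c.last_eq hp).symm))
  let N₂ : C(KProd X X, Y) := H'.comp ((ContinuousMap.const _ 1).prodMk (ContinuousMap.id _))
  -- The deformation near the second axis does not disturb the first one, because `G'` is stationary
  -- at the base point.
  have hH'y : ∀ s x, H' (s, kpt x x₀) = hY.e := fun s x => by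
    refine (hH' (kpt x x₀) (fun _ s => ?_) s).trans (hN₁y _)
    exact (hG'e s).trans (hN₁y _).symm
  have hN₁N₂ : N₁.HomotopicRel N₂ S := by
    refine (homotopicRel_postcomp hRS' N₁).trans (homotopicRel_iff.2 ⟨H', hH'0, fun _ => rfl, ?_⟩)
    rintro t _ rfl
    exact (hH'y t x₀).trans (hN₁y _).symm
  have hwedge : ∀ p, kFst p = x₀ ∨ kSnd p = x₀ → N₂ p = hY.e := by
    rintro p (hp | hp)
    · refine (congrArg (fun x => N₂ (kpt x (kSnd p))) hp).trans ?_
      exact (hH'1 (kpt x₀ (kSnd p)) c.v_pt).trans (hG'1 _)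
    · refine (congrArg (fun y => N₂ (kpt (kFst p) y)) hp).trans (hH'y 1 _)
  refine ⟨smashLift N₂ hY.e hwedge, hwedge _ (Or.inl rfl), ?_⟩
  have hN₂ : ∀ p ∈ S, N₂ p = hY.e := by
    rintro _ rfl
    exact hwedge _ (Or.inl rfl)
  have hfin : HClass.mk N₂ hN₂ * HClass.mk P hP = Q := by
    rw [← hd]
    exact congrArg (· * HClass.mk P hP) (HClass.mk_eq_mk.2 (hNN₁.trans hN₁N₂).symm)
  exact HClass.mk_eq_mk.1 hfin

end KHSpace

/-! ### Pointwise structure on free loop spaces. -/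

section FreeLoops

variable {X Y Z : Type u} [TopologicalSpace X] [TopologicalSpace Y] [TopologicalSpace Z]

/-- Homotopic maps induce homotopic maps of free loop spaces. -/
theorem freeMap_homotopicRel_freeMap {f g : C(X, Y)} {x : X} (H : f.HomotopicRel g {x}) :
    (freeMap f).HomotopicRel (freeMap g) {freeConst x} := by
  obtain ⟨H, h0, h1, hS⟩ := homotopicRel_iff.1 H
  refine homotopicRel_iff.2 ⟨freeCurry (T := I × FreeLoop X)
    ⟨fun p => H (p.1.1, freeEval X (p.1.2, p.2)), by fun_prop⟩
    (fun q => congrArg (fun z => H (q.1, z)) (kOut _ q.2).2), ?_, ?_, ?_⟩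
  · intro γ
    exact congrArg kPt (Subtype.ext (ContinuousMap.ext fun t => h0 _))
  · intro γ
    exact congrArg kPt (Subtype.ext (ContinuousMap.ext fun t => h1 _))
  · rintro t _ rfl
    exact congrArg kPt (Subtype.ext (ContinuousMap.ext fun s => hS t x rfl))

/-- A pair of free loops as a free loop in the product. -/
def freeZip (X Y : Type u) [TopologicalSpace X] [TopologicalSpace Y] :
    C(KProd (FreeLoop X) (FreeLoop Y), FreeLoop (KProd X Y)) :=
  freeCurry (kPair ((freeEval X).comp (kFst.prodMap (ContinuousMap.id I)))
      ((freeEval Y).comp (kSnd.prodMap (ContinuousMap.id I))))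
    (fun p => congrArg kPt (Prod.ext (kOut _ (kFst p)).2 (kOut _ (kSnd p)).2))

theorem KHSpace.freeLoop_isHomotopyAssoc [IsCG Y] {h : KHSpace Y} (ha : h.IsHomotopyAssoc) :
    h.freeLoop.IsHomotopyAssoc :=
  homotopicRel_precomp (freeMap_homotopicRel_freeMap ha)
    ((freeZip Y (KProd Y Y)).comp (kMap (ContinuousMap.id _) (freeZip Y Y))) (by
      rintro _ rfl
      rfl)

/-- A deviation of a map induces, pointwise, a deviation of the map of free loop spaces. -/
theorem KHSpace.IsDeviation.exists_freeLoop [IsCG X] [IsCG Y] {hX : KHSpace X} {hY : KHSpace Y}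
    {f : C(X, Y)} {D : C(Smash hX.e hX.e, Y)} (hD : hX.IsDeviation hY f D) :
    ∃ D', hX.freeLoop.IsDeviation hY.freeLoop (freeMap f) D' := by
  have hw : ∀ p : KProd (FreeLoop X) (FreeLoop X),
      kFst p = hX.freeLoop.e ∨ kSnd p = hX.freeLoop.e →
      (freeMap (D.comp (smashMk hX.e hX.e))).comp (freeZip X X) p = hY.freeLoop.e := by
    intro p hp
    have ht : ∀ t, D (smashMk hX.e hX.e (kpt (freeEval X (kFst p, t)) (freeEval X (kSnd p, t)))) =
        hY.e := fun t => (congrArg D (smashMk_eq_smashPt (hp.imp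
      (fun h => congrArg (fun γ : FreeLoop X => freeEval X (γ, t)) h)
      (fun h => congrArg (fun γ : FreeLoop X => freeEval X (γ, t)) h)))).trans hD.1
    change _ = freeConst hY.e
    exact congrArg (kPt (Y := {γ : C(I, Y) // γ 0 = γ 1})) (Subtype.ext (ContinuousMap.ext ht))
  refine ⟨smashLift _ _ hw, hw _ (Or.inl rfl), ?_⟩
  exact homotopicRel_precomp (freeMap_homotopicRel_freeMap hD.2) (freeZip X X) (by
    rintro _ rfl
    rfl)

end FreeLoops

/-! ### Based loops: contraction, lifting from free loops, reversal and concatenation. -/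

section BasedLoops

variable {T Y : Type u} [TopologicalSpace T] [TopologicalSpace Y] [IsCG T] {y : Y}

/-- The map to the based loop space with adjoint `f`. -/
def basedCurry (f : C(T × I, Y)) (h0 : ∀ x, f (x, 0) = y) (h1 : ∀ x, f (x, 1) = y) :
    C(T, BasedLoop y) :=
  kLift ⟨fun x => ⟨f.curry x, h0 x, h1 x⟩, continuous_induced_rng.2 f.curry.continuous⟩

/-- The evaluation of based loops. -/
def basedEval (y : Y) : C(BasedLoop y × I, Y) :=
  (freeEval Y).comp ((loopIncl y).prodMap (ContinuousMap.id I))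

theorem basedEval_zero (γ : BasedLoop y) : basedEval y (γ, 0) = y := (kOut (Path y y) γ).source

theorem basedEval_one (γ : BasedLoop y) : basedEval y (γ, 1) = y := (kOut (Path y y) γ).target

theorem basedLoop_ext {γ δ : BasedLoop y} (h : ∀ t, basedEval y (γ, t) = basedEval y (δ, t)) :
    γ = δ :=
  congrArg (kPt (Y := Path y y)) (Path.ext (funext h))

theorem freeLoop_ext {γ δ : FreeLoop Y} (h : ∀ t, freeEval Y (γ, t) = freeEval Y (δ, t)) :
    γ = δ :=
  congrArg (kPt (Y := {γ : C(I, Y) // γ 0 = γ 1})) (Subtype.ext (ContinuousMap.ext h))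

/-- A homotopy of free loops given by its adjoint. -/
theorem homotopicRel_of_freeCurry {f g : C(T, FreeLoop Y)} {S : Set T} (H : C((I × T) × I, Y))
    (hH : ∀ q, H (q, 0) = H (q, 1)) (h0 : ∀ x t, H ((0, x), t) = freeEval Y (f x, t))
    (h1 : ∀ x t, H ((1, x), t) = freeEval Y (g x, t))
    (hS : ∀ s, ∀ x ∈ S, ∀ t, H ((s, x), t) = freeEval Y (f x, t)) : f.HomotopicRel g S :=
  homotopicRel_iff.2 ⟨freeCurry H hH, fun x => freeLoop_ext (h0 x), fun x => freeLoop_ext (h1 x),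
    fun s x hx => freeLoop_ext (hS s x hx)⟩

/-- A contraction of a neighborhood of `y` acts pointwise on the loops at `y`. -/
noncomputable def NbhdContraction.basedLoop (c : NbhdContraction y) :
    NbhdContraction (basedConst y) :=
  let φ : C(BasedLoop y, C(I, ℝ)) :=
    (⟨fun q => (c.v (basedEval y q) : ℝ), by fun_prop⟩ : C(BasedLoop y × I, ℝ)).curry
  have hφ : ∀ γ t, ‖φ γ t‖ = c.v (basedEval y (γ, t)) := fun γ t =>
    Real.norm_of_nonneg (c.v (basedEval y (γ, t))).2.1
  -- The supremum of `c.v` along the loop: if it is at most `1/2`, the whole loop lies in the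
  -- contracted neighborhood.
  { v := ⟨fun γ => ⟨‖φ γ‖, norm_nonneg _, (ContinuousMap.norm_le _ zero_le_one).2 fun t =>
        (hφ γ t).trans_le (c.v (basedEval y (γ, t))).2.2⟩, by fun_prop⟩
    F := basedCurry (T := I × BasedLoop y)
      ⟨fun q => c.F (q.1.1, basedEval y (q.1.2, q.2)), by fun_prop⟩
      (fun x => (congrArg (fun z => c.F (x.1, z)) (basedEval_zero x.2)).trans (c.F_pt _))
      (fun x => (congrArg (fun z => c.F (x.1, z)) (basedEval_one x.2)).trans (c.F_pt _))
    v_pt := by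
      refine Subtype.ext (le_antisymm ((ContinuousMap.norm_le _ le_rfl).2 fun t => ?_)
        (norm_nonneg _))
      rw [hφ]
      exact (congrArg Subtype.val c.v_pt).le
    F_zero := fun γ => basedLoop_ext fun t => c.F_zero _
    F_pt := fun s => basedLoop_ext fun t => c.F_pt s
    F_one := fun γ hγ => basedLoop_ext fun t => c.F_one _
      (((hφ γ t).ge.trans (ContinuousMap.norm_coe_le_norm (φ γ) t)).trans hγ) }

/-- A based family of free loops whose family of initial points is null-homotopic is homotopic to
a family of based loops. -/
theorem exists_basedLoop_lift {x₀ : T} (D : C(T, FreeLoop Y)) (hD : D x₀ = freeConst y)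
    (hnull : ((freeProj Y).comp D).HomotopicRel (ContinuousMap.const T y) {x₀}) :
    ∃ d : C(T, BasedLoop y), d x₀ = basedConst y ∧
      ((loopIncl y).comp d).HomotopicRel D {x₀} := by
  obtain ⟨P, hP0, hP1, hP⟩ := homotopicRel_iff.1 hnull
  have hDx : ∀ t, freeEval Y (D x₀, t) = y := fun t => congrArg (fun γ => freeEval Y (γ, t)) hD
  have hPx : ∀ s, P (s, x₀) = y := fun s => (hP s x₀ rfl).trans (hDx 0)
  have hP0' : ∀ x, P (0, x) = freeEval Y (D x, 0) := hP0
  have hend : ∀ x, freeEval Y (D x, 0) = freeEval Y (D x, 1) := fun x => (kOut _ (D x)).2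
  let p : C(ℝ, I) := ⟨Set.projIcc 0 1 zero_le_one, continuous_projIcc⟩
  have hp1 : ∀ x : ℝ, 1 ≤ x → p x = 1 := fun x hx => Set.projIcc_of_right_le zero_le_one hx
  have hp0 : ∀ x : ℝ, x ≤ 0 → p x = 0 := fun x hx => Set.projIcc_of_le_left zero_le_one hx
  have hpv : ∀ t : I, p t = t := fun t => Set.projIcc_val zero_le_one t
  -- At stage `s` the loop follows the track of `P` from stage `s` back to 0 during `[0, s/4]`, then
  -- runs through `D x` on `[s/4, 1 - s/4]`, then returns along the track.
  let K : C((I × T) × I, Y) :=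
    { toFun := fun q => if (q.1.1 : ℝ) / 4 ≤ min (q.2 : ℝ) (1 - q.2) then
          freeEval Y (D q.1.2, p (((q.2 : ℝ) - q.1.1 / 4) / (1 - q.1.1 / 2)))
        else P (p (q.1.1 - 4 * min (q.2 : ℝ) (1 - q.2)), q.1.2)
      continuous_toFun := by
        have hne : ∀ q : (I × T) × I, (1 : ℝ) - q.1.1 / 2 ≠ 0 := fun q => by
          linarith [q.1.1.2.2]
        refine Continuous.if_le ?_ (by fun_prop) (by fun_prop) (by fun_prop) ?_
        · exact (freeEval Y).continuous.comp (Continuous.prodMk (by fun_prop)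
            (p.continuous.comp (Continuous.div (by fun_prop) (by fun_prop) hne)))
        · rintro ⟨⟨s, x⟩, t⟩ hq
          replace hq : (s : ℝ) / 4 = min (t : ℝ) (1 - t) := hq
          change freeEval Y (D x, p (((t : ℝ) - s / 4) / (1 - s / 2))) =
            P (p (s - 4 * min (t : ℝ) (1 - t)), x)
          have hs := s.2.2
          rw [hp0 (s - 4 * min (t : ℝ) (1 - t)) (by linarith), hP0']
          rcases le_total (t : ℝ) (1 - t) with h | h
          · rw [min_eq_left h] at hq
            rw [hq, sub_self, zero_div, hp0 _ le_rfl]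
          · rw [min_eq_right h] at hq
            have : ((t : ℝ) - s / 4) / (1 - s / 2) = 1 := by
              rw [div_eq_one_iff_eq (by linarith)]
              linarith
            rw [this, hp1 _ le_rfl, hend] }
  have hK : ∀ s x t, K ((s, x), t) = if (s : ℝ) / 4 ≤ min (t : ℝ) (1 - t) then
          freeEval Y (D x, p (((t : ℝ) - s / 4) / (1 - s / 2)))
        else P (p (s - 4 * min (t : ℝ) (1 - t)), x) := fun _ _ _ => rfl
  have hKx : ∀ s t, K ((s, x₀), t) = y := fun s t => by
    rw [hK, hDx, hPx, ite_self]
  have hK0 : ∀ x t, K ((0, x), t) = freeEval Y (D x, t) := fun x t => by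
    have h1 := t.2.1
    have h2 := t.2.2
    rw [hK, if_pos]
    · simp [hpv]
    · rw [Set.Icc.coe_zero, zero_div]
      exact le_min h1 (by linarith)
  have hKt : ∀ s x t, (t = 0 ∨ t = 1) → K ((s, x), t) = P (s, x) := fun s x t ht => by
    have hmin : min (t : ℝ) (1 - t) = 0 := by rcases ht with rfl | rfl <;> simp
    rw [hK, hmin]
    split_ifs with h
    · have hs : s = 0 := le_antisymm (Subtype.coe_le_coe.1 (by
        rw [Set.Icc.coe_zero]
        linarith)) s.2.1
      subst hs
      rw [hP0']
      rcases ht with rfl | rfl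
      · simp [hp0 0 le_rfl]
      · simp [hp1 1 le_rfl, hend]
    · rw [mul_zero, sub_zero, hpv]
  let K₁ : C(T × I, Y) := K.comp (((ContinuousMap.const T 1).prodMk (ContinuousMap.id T)).prodMap
    (ContinuousMap.id I))
  refine ⟨basedCurry K₁ (fun x => (hKt 1 x 0 (Or.inl rfl)).trans (hP1 x))
    (fun x => (hKt 1 x 1 (Or.inr rfl)).trans (hP1 x)), basedLoop_ext fun t => hKx 1 t,
    (homotopicRel_of_freeCurry K (fun q => (hKt q.1 q.2 0 (Or.inl rfl)).trans
      (hKt q.1 q.2 1 (Or.inr rfl)).symm) hK0 (fun _ _ => rfl) ?_).symm⟩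
  rintro s _ rfl t
  rw [hKx, hDx]

/-- The concatenation of the reversal of a loop with the loop is null-homotopic. -/
theorem loopIncl_loopMul_loopInv_homotopicRel (y : Y) :
    ((loopIncl y).comp ((loopMul y).comp (kPair (loopInv y) (ContinuousMap.id _)))).HomotopicRel
      (ContinuousMap.const _ (freeConst y)) {basedConst y} := by
  let p : C(ℝ, I) := ⟨Set.projIcc 0 1 zero_le_one, continuous_projIcc⟩
  have hp1 : ∀ x : ℝ, 1 ≤ x → p x = 1 := fun x hx => Set.projIcc_of_right_le zero_le_one hx
  -- At time `t` the reversal followed by the loop is the loop at `|2t - 1|`. The lower bound `s`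
  -- cuts off the backtracking until only the end point remains.
  let H : C((I × BasedLoop y) × I, Y) :=
    ⟨fun q => basedEval y (q.1.2, p (max |2 * (q.2 : ℝ) - 1| q.1.1)), by fun_prop⟩
  have hH : ∀ s γ t, H ((s, γ), t) = basedEval y (γ, p (max |2 * (t : ℝ) - 1| s)) :=
    fun _ _ _ => rfl
  have h0 : ∀ γ t, H ((0, γ), t) = freeEval Y
      ((loopIncl y).comp ((loopMul y).comp (kPair (loopInv y) (ContinuousMap.id _))) γ, t) := by
    intro γ t
    change _ = ((kOut (Path y y) γ).symm.trans (kOut (Path y y) γ)) t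
    rw [hH, Set.Icc.coe_zero, max_eq_left (abs_nonneg _), Path.trans_apply]
    split_ifs with h
    · rw [abs_of_nonpos (by linarith), Path.symm_apply]
      refine congrArg (fun t => basedEval y (γ, t)) (Subtype.ext ?_)
      change max 0 (min 1 (-(2 * (t : ℝ) - 1))) = 1 - 2 * t
      have := t.2.1
      rw [min_eq_right (by linarith), max_eq_right (by linarith)]
      ring
    · rw [abs_of_nonneg (by linarith)]
      refine congrArg (fun t => basedEval y (γ, t)) (Subtype.ext ?_)
      change max 0 (min 1 (2 * (t : ℝ) - 1)) = 2 * t - 1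
      have := t.2.2
      rw [min_eq_right (by linarith), max_eq_right (by linarith)]
  refine homotopicRel_of_freeCurry H (fun q => ?_) h0 (fun γ t => ?_) ?_
  · refine (hH _ _ _).trans (Eq.trans ?_ (hH _ _ _).symm)
    norm_num
  · rw [hH, Set.Icc.coe_one, hp1 _ (le_max_right _ _), basedEval_one]
    rfl
  · rintro s _ rfl t
    rw [← h0]
    rfl

end BasedLoops

namespace KHSpace

variable {C : Type u} [TopologicalSpace C] [IsCG C] (h : KHSpace C)

/-- The pointwise product of based loops is homotopic to their concatenation. -/
theorem freeMul_loopIncl_homotopicRel_loopMul :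
    (h.freeMul.comp (kMap (loopIncl h.e) (loopIncl h.e))).HomotopicRel
      ((loopIncl h.e).comp (loopMul h.e)) {kpt (basedConst h.e) (basedConst h.e)} := by
  let T := KProd (BasedLoop h.e) (BasedLoop h.e)
  obtain ⟨L, hL0, hL1, hL⟩ := homotopicRel_iff.1 h.one_mul
  obtain ⟨R, hR0, hR1, hR⟩ := homotopicRel_iff.1 h.mul_one
  have hLe : ∀ s, L (s, h.e) = h.e := fun s => (hL s _ rfl).trans h.mul_e_e
  have hRe : ∀ s, R (s, h.e) = h.e := fun s => (hR s _ rfl).trans h.mul_e_e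
  let p : C(ℝ, I) := ⟨Set.projIcc 0 1 zero_le_one, continuous_projIcc⟩
  have hp1 : ∀ x : ℝ, 1 ≤ x → p x = 1 := fun x hx => Set.projIcc_of_right_le zero_le_one hx
  have hp0 : ∀ x : ℝ, x ≤ 0 → p x = 0 := fun x hx => Set.projIcc_of_le_left zero_le_one hx
  have hpv : ∀ t : I, p t = t := fun t => Set.projIcc_val zero_le_one t
  let a : C(T × I, C) := (basedEval h.e).comp (kFst.prodMap (ContinuousMap.id I))
  let b : C(T × I, C) := (basedEval h.e).comp (kSnd.prodMap (ContinuousMap.id I))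
  have ha0 : ∀ x, a (x, 0) = h.e := fun x => basedEval_zero _
  have ha1 : ∀ x, a (x, 1) = h.e := fun x => basedEval_one _
  have hb0 : ∀ x, b (x, 0) = h.e := fun x => basedEval_zero _
  have hb1 : ∀ x, b (x, 1) = h.e := fun x => basedEval_one _
  -- The factors are slid apart in time until `a` moves only in the first half and `b` only in the
  -- second.
  let H : C((I × T) × I, C) := h.mul.comp (kPair
    ⟨fun q => a (q.1.2, p ((1 + q.1.1) * q.2)), by fun_prop⟩
    ⟨fun q => b (q.1.2, p ((1 + q.1.1) * q.2 - q.1.1)), by fun_prop⟩)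
  have hH : ∀ (s : I) x (t : I), H ((s, x), t) =
    h.mul (kpt (a (x, p ((1 + s) * t))) (b (x, p ((1 + s) * t - s)))) := fun _ _ _ => rfl
  have hHend : ∀ q, H (q, 0) = H (q, 1) := by
    rintro ⟨s, x⟩
    have hs := s.2.1
    rw [hH, hH, hp0 ((1 + s) * (0 : I)) (by simp), hp0 ((1 + s) * (0 : I) - s) (by simpa using hs),
      hp1 ((1 + s) * (1 : I)) (by simpa using hs), hp1 ((1 + s) * (1 : I) - s) (by simp), ha0, ha1,
      hb0, hb1]
  let X : C(T, FreeLoop C) := (freeCurry (T := I × T) H hHend).comp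
    ((ContinuousMap.const T 1).prodMk (ContinuousMap.id T))
  have hX : ∀ x (t : I), freeEval C (X x, t) =
      h.mul (kpt (a (x, p (2 * t))) (b (x, p (2 * t - 1)))) := fun x t => by
    change h.mul (kpt (a (x, p ((1 + (1 : I)) * t))) (b (x, p ((1 + (1 : I)) * t - (1 : I))))) = _
    rw [Set.Icc.coe_one, one_add_one_eq_two]
  -- In each half one factor now rests at the unit and is removed by a unit homotopy. These agree at
  -- `t = 1/2` since both fix the unit.
  let G : C((I × T) × I, C) :=
    { toFun := fun q => if (q.2 : ℝ) ≤ 1 / 2 then R (q.1.1, a (q.1.2, p (2 * q.2)))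
        else L (q.1.1, b (q.1.2, p (2 * q.2 - 1)))
      continuous_toFun := by
        refine Continuous.if_le (by fun_prop) (by fun_prop) (by fun_prop) (by fun_prop) ?_
        intro q hq
        rw [hp1 _ (by linarith), hp0 _ (by linarith), ha1, hb0, hLe, hRe] }
  have hG : ∀ (s : I) x (t : I), G ((s, x), t) = if (t : ℝ) ≤ 1 / 2 then R (s, a (x, p (2 * t)))
        else L (s, b (x, p (2 * t - 1))) := fun _ _ _ => rfl
  have hG0 : ∀ x t, G ((0, x), t) = freeEval C (X x, t) := fun x t => by
    rw [hG, hX]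
    split_ifs with ht
    · rw [hp0 (2 * t - 1) (by linarith), hb0]
      exact hR0 _
    · rw [hp1 (2 * t) (by linarith), ha1]
      exact hL0 _
  refine HomotopicRel.trans (g := X) (homotopicRel_of_freeCurry H hHend (fun x t => ?_)
    (fun _ _ => rfl) ?_) (homotopicRel_of_freeCurry G (fun q => ?_) hG0 (fun x t => ?_) ?_)
  · rw [hH, Set.Icc.coe_zero, add_zero, _root_.one_mul, sub_zero, hpv]
    rfl
  · rintro s _ rfl t
    rfl
  · rw [hG, hG, if_pos (by simp), if_neg (by norm_num), hp0 _ (by simp), hp1 _ (by norm_num), ha0,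
      hb1, hLe, hRe]
  · rw [hG, hR1, hL1]
    change _ = ((kOut (Path h.e h.e) (kFst x)).trans (kOut (Path h.e h.e) (kSnd x))) t
    rw [Path.trans_apply]
    split_ifs with ht
    · rw [← Path.extend_apply]
      rfl
    · rw [← Path.extend_apply]
      rfl
  · rintro s _ rfl t
    rw [hG, hX]
    refine Eq.trans ?_ h.mul_e_e.symm
    split_ifs
    · exact hRe s
    · exact hLe s

end KHSpace

/-! ### Deviations restricted to ΩB × B, and the theorem. -/

section Deviation

variable {B C : Type u} [TopologicalSpace B] [TopologicalSpace C] [IsCG B] [IsCG C]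
  {hB : KHSpace B} {hC : KHSpace C} {w : C(B, C)}

/-- The product of the inclusion of the based loops and the section. -/
abbrev loopSectionMap (hB : KHSpace B) :
    C(KProd (BasedLoop hB.e) B, KProd (FreeLoop B) (FreeLoop B)) :=
  kMap (loopIncl hB.e) (freeSection B)

theorem loopSectionMap_mapsTo :
    Set.MapsTo (loopSectionMap hB) {kpt (basedConst hB.e) hB.e}
      {kpt hB.freeLoop.e hB.freeLoop.e} := by
  rintro _ rfl
  rfl

open KHSpace in
/-- The initial points of a deviation of a map of free loop spaces form a null-homotopic map on
the smash product of the based loops and the space. -/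
theorem freeProj_deviation_homotopicRel_const [Fact hC.IsHomotopyAssoc] {ι : C(C, C)}
    (hι : hC.IsRightInverse ι) (c : NbhdContraction hB.e) (hw : w hB.e = hC.e)
    {D : C(Smash hB.freeLoop.e hB.freeLoop.e, FreeLoop C)}
    (hD : hB.freeLoop.IsDeviation hC.freeLoop (freeMap w) D) :
    ((freeProj C).comp (D.comp (smashMap (loopIncl hB.e) (freeSection B) rfl rfl))).HomotopicRel
      (ContinuousMap.const _ hC.e) {smashPt (basedConst hB.e) hB.e} := by
  let g : C(Smash (basedConst hB.e) hB.e, C) :=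
    (freeProj C).comp (D.comp (smashMap (loopIncl hB.e) (freeSection B) rfl rfl))
  have hg : g (smashPt (basedConst hB.e) hB.e) = hC.e := congrArg (freeProj C) hD.1
  refine hι.homotopicRel_const_of_smashMk c.basedLoop c g hg ?_
  let S : Set (KProd (BasedLoop hB.e) B) := {kpt (basedConst hB.e) hB.e}
  have hA : ∀ p ∈ S, g.comp (smashMk (basedConst hB.e) hB.e) p = hC.e := by
    rintro _ rfl
    exact hg
  have hW : ∀ p ∈ S, w.comp kSnd p = hC.e := by
    rintro _ rfl
    exact hw
  have hW' : ∀ p ∈ S, (w.comp (hB.mul.comp (kPair (ContinuousMap.const B hB.e)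
      (ContinuousMap.id B)))).comp kSnd p = hC.e := by
    rintro _ rfl
    exact (congrArg w hB.mul_e_e).trans hw
  have hWW' : (HClass.mk _ hW' : hC.HClass S) = HClass.mk _ hW :=
    HClass.mk_eq_mk.2 (homotopicRel_precomp (homotopicRel_postcomp hB.one_mul w) kSnd (by
      rintro _ rfl
      rfl))
  have hdev := homotopicRel_postcomp
    (homotopicRel_precomp hD.2 (loopSectionMap hB) loopSectionMap_mapsTo) (freeProj C)
  -- The deviation relation at time 0, where a based loop is at the unit of `B`, which `w` sends to
  -- the unit of `C`.
  have key : (HClass.mk _ hA * HClass.mk _ hW' : hC.HClass S) = 1 * HClass.mk _ hW := by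
    refine HClass.mk_eq_mk.2 ?_
    convert! hdev using 1
    · refine ContinuousMap.ext fun p => congrArg (fun b => hC.mul (kpt _ (w (hB.mul (kpt b _))))) ?_
      exact (basedEval_zero (kFst p)).symm
    · refine ContinuousMap.ext fun p => congrArg (fun b => hC.mul (kpt b (w (kSnd p)))) ?_
      exact hw.symm.trans (congrArg w (basedEval_zero (kFst p)).symm)
  rw [hWW'] at key
  exact HClass.mk_eq_mk.1 ((hι.isUnit (HClass.mk _ hW)).mul_left_inj.1 key)

open KHSpace in
/-- The composite of the splitting with the map of free loop spaces is determined by a loop lift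
of a deviation. -/
theorem freeMap_splitting_homotopicRel (ha : hC.IsHomotopyAssoc) (hw : w hB.e = hC.e)
    {D : C(Smash hB.freeLoop.e hB.freeLoop.e, FreeLoop C)}
    (hD : hB.freeLoop.IsDeviation hC.freeLoop (freeMap w) D)
    {d : C(Smash (basedConst hB.e) hB.e, BasedLoop hC.e)} (hd : IsLoopLift hB hC D d) :
    ((freeMap w).comp hB.splitting).HomotopicRel
      (explicitComposite hB hC w hw ((loopInv hC.e).comp d)) {kpt (basedConst hB.e) hB.e} := by
  have : Fact hC.freeLoop.IsHomotopyAssoc := ⟨freeLoop_isHomotopyAssoc ha⟩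
  let S : Set (KProd (BasedLoop hB.e) B) := {kpt (basedConst hB.e) hB.e}
  let q := smashMk (basedConst hB.e) hB.e
  have incl : ∀ {α : C(KProd (BasedLoop hB.e) B, BasedLoop hC.e)}, (∀ p ∈ S, α p = basedConst hC.e) →
      ∀ p ∈ S, (loopIncl hC.e).comp α p = hC.freeLoop.e :=
    fun hα p hp => congrArg (loopIncl hC.e) (hα p hp)
  have hmul : ∀ (α β : C(KProd (BasedLoop hB.e) B, BasedLoop hC.e))
      (hα : ∀ p ∈ S, α p = basedConst hC.e) (hβ : ∀ p ∈ S, β p = basedConst hC.e) hαβ,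
      (HClass.mk ((loopIncl hC.e).comp ((loopMul hC.e).comp (kPair α β))) hαβ :
        hC.freeLoop.HClass S) = HClass.mk _ (incl hα) * HClass.mk _ (incl hβ) := by
    intro α β hα hβ hαβ
    refine HClass.mk_eq_mk.2 (homotopicRel_precomp
      hC.freeMul_loopIncl_homotopicRel_loopMul (kPair α β) fun p hp => ?_).symm
    exact congrArg₂ kpt (hα p hp) (hβ p hp)
  have hconst : loopMul hC.e (kpt (basedConst hC.e) (basedConst hC.e)) = basedConst hC.e :=
    congrArg (kPt (Y := Path hC.e hC.e)) (Path.refl_trans_refl)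
  let δ := d.comp q
  have hδ : ∀ p ∈ S, δ p = basedConst hC.e := by
    rintro _ rfl
    exact hd.1
  let δ' := (loopInv hC.e).comp δ
  have hδ' : ∀ p ∈ S, δ' p = basedConst hC.e := fun p hp =>
    (congrArg (loopInv hC.e) (hδ p hp)).trans (congrArg (kPt (Y := Path hC.e hC.e)) Path.refl_symm)
  let W : C(KProd (BasedLoop hB.e) B, BasedLoop hC.e) := (basedMap w hw).comp kFst
  have hW : ∀ p ∈ S, W p = basedConst hC.e := by
    rintro _ rfl
    exact basedLoop_ext fun t => hw
  -- A left inverse of this one class suffices, and loop reversal provides it without a homotopy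
  -- inverse on the free loop space.
  have hinv : (HClass.mk _ (incl hδ') * HClass.mk _ (incl hδ) : hC.freeLoop.HClass S) = 1 := by
    rw [← hmul δ' δ hδ' hδ fun p hp => by
      change loopIncl hC.e (loopMul hC.e (kpt (δ' p) (δ p))) = _
      rw [hδ' p hp, hδ p hp, hconst]
      rfl]
    exact HClass.mk_eq_mk.2 (homotopicRel_precomp
      (loopIncl_loopMul_loopInv_homotopicRel hC.e) δ hδ)
  have hmulW : ∀ p ∈ S, (loopIncl hC.e).comp ((loopMul hC.e).comp (kPair δ' W)) p =
      hC.freeLoop.e := fun p hp => by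
    change loopIncl hC.e (loopMul hC.e (kpt (δ' p) (W p))) = _
    rw [hδ' p hp, hW p hp, hconst]
    rfl
  have hV : ∀ p ∈ S, ((freeSection C).comp w).comp kSnd p = hC.freeLoop.e := by
    rintro _ rfl
    exact congrArg (freeSection C) hw
  have hZ : ∀ p ∈ S, (freeMap w).comp hB.splitting p = hC.freeLoop.e := by
    rintro _ rfl
    exact freeLoop_ext fun t => (congrArg w hB.mul_e_e).trans hw
  have hdev : (HClass.mk _ (incl hδ) * HClass.mk _ hZ : hC.freeLoop.HClass S) =
      HClass.mk _ (incl hW) * HClass.mk _ hV := by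
    have hD' : ∀ p ∈ S, (D.comp (smashMap (loopIncl hB.e) (freeSection B) rfl rfl)).comp q p =
        hC.freeLoop.e := by
      rintro _ rfl
      exact hD.1
    have h1 : (HClass.mk _ (incl hδ) : hC.freeLoop.HClass S) = HClass.mk _ hD' :=
      HClass.mk_eq_mk.2 (homotopicRel_precomp hd.2 q (by
        rintro _ rfl
        rfl))
    rw [h1]
    exact HClass.mk_eq_mk.2 (homotopicRel_precomp hD.2 (loopSectionMap hB) loopSectionMap_mapsTo)
  have hfin : (HClass.mk _ hZ : hC.freeLoop.HClass S) = HClass.mk _ hmulW * HClass.mk _ hV := by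
    -- Concatenation becomes a product of classes, `Ωw * w` is replaced by `δ * (Lw ∘ θ)`, and `δ' *
    -- δ` cancels.
    rw [hmul δ' W hδ' hW hmulW, mul_assoc, ← hdev, ← mul_assoc, hinv, _root_.one_mul]
  exact HClass.mk_eq_mk.1 hfin

end Deviation

end ConvenientHSpaces

theorem mainTheorem6 {B C : Type u} [TopologicalSpace B] [TopologicalSpace C]
    [CompactlyGeneratedSpace B] [CompactlyGeneratedSpace C]
    (hB : KHSpace B) (hC : KHSpace C)
    (hBcw : HasCWHomotopyType B) (hCcw : HasCWHomotopyType C)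
    (hBnd : IsNondegenerate hB.e) (hCnd : IsNondegenerate hC.e)
    (hCassoc : hC.IsHomotopyAssoc) (hCgrp : hC.IsGrouplike)
    (w : C(B, C)) (hw : w hB.e = hC.e) :
    (∃ D, hB.freeLoop.IsDeviation hC.freeLoop (freeMap w) D) ∧
    ∀ D, hB.freeLoop.IsDeviation hC.freeLoop (freeMap w) D →
      (∃ d, IsLoopLift hB hC D d) ∧
      ∀ d, IsLoopLift hB hC D d →
        ((freeMap w).comp hB.splitting).HomotopicRel
          (explicitComposite hB hC w hw ((loopInv hC.e).comp d))
          {kpt (basedConst hB.e) hB.e} := by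
  have : Fact hC.IsHomotopyAssoc := ⟨hCassoc⟩
  obtain ⟨b⟩ := hBnd.exists_nbhdContraction
  obtain ⟨c⟩ := hCnd.exists_nbhdContraction
  obtain ⟨ι, hι⟩ := KHSpace.exists_isRightInverse hCgrp hCcw c
  -- A deviation is built for `w` itself, where inverses exist in `C`, and only then looped
  -- pointwise.
  obtain ⟨D₀, hD₀⟩ := KHSpace.exists_isDeviation hι b w hw
  refine ⟨hD₀.exists_freeLoop, fun D hD => ⟨?_, fun d hd => ?_⟩⟩
  · exact exists_basedLoop_lift _ hD.1 (freeProj_deviation_homotopicRel_const hι b hw hD)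
  · exact freeMap_splitting_homotopicRel hCassoc hw hD hd
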